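/- Let $n\ge 3$. For $\alpha_0,\dots,\alpha_{n-2}$ in the open unit disk $\mathbb D$ and $\alpha_{n-1}\in S^1$ put $\rho_k=\sqrt{1-|\alpha_k|^2}$, $\Xi_k=\begin{bmatrix}\bar\alpha_k&\rho_k\\ \rho_k&-\alpha_k\end{bmatrix}$ for $0\le k\le n-2$, $\Xi_{-1}=[1]$, $\Xi_{n-1}=[\bar\alpha_{n-1}]$. The associated CMV matrix is the $n\times n$ unitary matrix $\mathcal C=\mathcal L\mathcal M$ with $\mathcal L=\operatorname{diag}(\Xi_0,\Xi_2,\dots)$ and $\mathcal M=\operatorname{diag}(\Xi_{-1},\Xi_1,\dots)$. Fix $\alpha_{n-1}\in S^1$ and let $M$ be the manifold of CMV matrices with this last coefficient (equivalently, with determinant $(-1)^{n-1}\bar\alpha_{n-1}$), on which $(\alpha_0,\dots,\alpha_{n-2})\in\mathbb D^{n-1}$ are coordinates. A matrix $\mathcal C\in M$ has $n$ distinct eigenvalues; on an open subset of $M$ label them continuously as $e^{i\theta_1},\dots,e^{i\theta_n}$, in any order, and let $\mu_j>0$ be the mass at $e^{i\theta_j}$ of the spectral measure of $\mathcal C$ and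 the vector $e_1=[1,0,\dots,0]^T$. The Ablowitz--Ladik bracket of functions of $\alpha_j=u_j+iv_j$, $0\le j\le n-2$, is $$\{f,g\}=\sum_{j=0}^{n-2}\rho_j^2\Bigl[\frac{\partial f}{\partial u_j}\frac{\partial g}{\partial v_j}-\frac{\partial f}{\partial v_j}\frac{\partial g}{\partial u_j}\Bigr].$$ The Gelfand--Dikij bracket of real functions $\phi,\psi$ on the space of all complex $n\times n$ matrices is $$\{\phi,\psi\}\big|_B=\tfrac12\langle R(XB),YB\rangle-\tfrac12\langle R(BX),BY\rangle,\qquad X=\nabla\phi|_B,\ Y=\nabla\psi|_B,$$ where $\langle X,Y\rangle=\operatorname{Im}\operatorname{tr}(XY)$, $\nabla\phi$ is the gradient with respect to this pairing, that is, $\frac{d}{dt}\big|_{t=0}\phi(B+tC)=\langle\nabla\phi|_B,C\rangle$, and $R(L+A)=L-A$ for $L$ lower triangular with real diagonal and $A$ anti-Hermitian. For functions on $M$ it is evaluated at a point of $M$ by means of extensions, differentiable at that point, to the space of all matrices. Then the functions $\log[\mu_2/\mu_1]$ and $\log[\mu_3/\mu_1]$ are smooth in $(\alpha_0,\dots,\alpha_{n-2})$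 and, near each point where they are defined, extend smoothly from $M$ to the space of all matrices; and for any labelling of the eigenvalues $$\bigl\{\log[\mu_2/\mu_1],\log[\mu_3/\mu_1]\bigr\}=2\cot\bigl(\tfrac{\theta_1-\theta_2}2\bigr)+2\cot\bigl(\tfrac{\theta_2-\theta_3}2\bigr)+2\cot\bigl(\tfrac{\theta_3-\theta_1}2\bigr)$$ both in the Ablowitz--Ladik bracket and in the Gelfand--Dikij bracket (for any choice of the extensions). -/

import Mathlib

open scoped Topology ContDiff ComplexConjugate

/- Matrices carry the entrywise sup norm; as the space is finite-dimensional, derivatives and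
smoothness do not depend on this choice. -/
attribute [local instance] Matrix.normedAddCommGroup Matrix.normedSpace

namespace CMV

noncomputable section

/-! ### CMV matrices -/

/-- `ρ = √(1 - |α|²)`. -/
def rho (z : ℂ) : ℝ := Real.sqrt (1 - ‖z‖ ^ 2)

/-- The block-diagonal matrix whose blocks are the `Ξ_k` with `k ≡ p (mod 2)`, for `p = 0, 1`.
With rows and columns numbered from `0`, the `2 × 2` block
`Ξ_k = [[conj α_k, ρ_k], [ρ_k, -α_k]]` occupies the indices `k, k + 1`, the `1 × 1` block
`Ξ_{n-1} = [conj α_{n-1}]` the last index, and `Ξ_{-1} = [1]` the index `0` (when `p = 1`). -/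
def factor {n : ℕ} (p : ℕ) (α : Fin n → ℂ) : Matrix (Fin n) (Fin n) ℂ :=
  Matrix.of fun i j =>
    if i = j then
      if i.val % 2 = p then conj (α i)
      else if i.val = 0 then 1
      else -α ⟨i.val - 1, by omega⟩
    else if i.val + 1 = j.val ∧ i.val % 2 = p then (rho (α i) : ℂ)
    else if j.val + 1 = i.val ∧ j.val % 2 = p then (rho (α j) : ℂ)
    else 0

/-- The CMV matrix `𝓒 = 𝓛 𝓜`, with `𝓛 = diag(Ξ₀, Ξ₂, …)` and `𝓜 = diag(Ξ₋₁, Ξ₁, …)`. -/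
def cmv {n : ℕ} (α : Fin n → ℂ) : Matrix (Fin n) (Fin n) ℂ :=
  factor 0 α * factor 1 α

/-- The `n × n` CMV matrix, `n = m + 1`, with Verblunsky coefficients `α₀, …, α_{n-2}` and
last coefficient `α_{n-1} = a`. -/
def cmvAt {m : ℕ} (a : ℂ) (α : Fin m → ℂ) : Matrix (Fin (m + 1)) (Fin (m + 1)) ℂ :=
  cmv (Fin.snoc (α := fun _ => ℂ) α a)

/-- The manifold of CMV matrices with `α₀, …, α_{n-2}` in the open unit disk and fixed
`α_{n-1} = a`, that is, with fixed determinant `(-1)^{n-1} conj a`. -/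
def leaf (m : ℕ) (a : ℂ) : Set (Matrix (Fin (m + 1)) (Fin (m + 1)) ℂ) :=
  {B | ∃ α : Fin m → ℂ, (∀ k, ‖α k‖ < 1) ∧ B = cmvAt a α}

/-! ### Eigenvalues and spectral measure -/

/-- The mass at `z` of the spectral measure of `B` and `e₁`: the squared norm of the orthogonal
projection of `e₁` to the eigenspace of `B` at `z` (for a unitary matrix `B`). -/
def spectralMass {m : ℕ} (B : Matrix (Fin (m + 1)) (Fin (m + 1)) ℂ) (z : ℂ) : ℝ :=
  ‖(Module.End.eigenspace (Matrix.toEuclideanLin B) z).starProjection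
    (EuclideanSpace.single (0 : Fin (m + 1)) (1 : ℂ))‖ ^ 2

/-- `θ` is a continuous enumeration, over the set `S` of matrices, of the eigenvalues
`e^{iθ_1}, …, e^{iθ_n}`, which are pairwise distinct. -/
structure IsLabelling {n : ℕ} (S : Set (Matrix (Fin n) (Fin n) ℂ))
    (θ : Matrix (Fin n) (Fin n) ℂ → Fin n → ℝ) : Prop where
  continuousOn : ContinuousOn θ S
  range_eq : ∀ B ∈ S, Set.range (fun j => Complex.exp (θ B j * Complex.I)) = spectrum ℂ B
  injective : ∀ B ∈ S, Function.Injective fun j => Complex.exp (θ B j * Complex.I)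

/-- `μ_j`, the mass of the eigenvalue `e^{iθ_j}`. -/
def mass {m : ℕ} (θ : Matrix (Fin (m + 1)) (Fin (m + 1)) ℂ → Fin (m + 1) → ℝ)
    (j : Fin (m + 1)) (B : Matrix (Fin (m + 1)) (Fin (m + 1)) ℂ) : ℝ :=
  spectralMass B (Complex.exp (θ B j * Complex.I))

/-- `log (μ_j / μ_k)`. -/
def logRatio {m : ℕ} (θ : Matrix (Fin (m + 1)) (Fin (m + 1)) ℂ → Fin (m + 1) → ℝ)
    (j k : Fin (m + 1)) (B : Matrix (Fin (m + 1)) (Fin (m + 1)) ℂ) : ℝ :=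
  Real.log (mass θ j B / mass θ k B)

/-! ### The Ablowitz–Ladik bracket -/

/-- `{f, g} = ∑_j ρ_j² (∂f/∂u_j ∂g/∂v_j - ∂f/∂v_j ∂g/∂u_j)`, where `α_j = u_j + i v_j`. -/
def alBracket {m : ℕ} (f g : (Fin m → ℂ) → ℝ) (α : Fin m → ℂ) : ℝ :=
  ∑ j, rho (α j) ^ 2 *
    (fderiv ℝ f α (Pi.single j 1) * fderiv ℝ g α (Pi.single j Complex.I)
      - fderiv ℝ f α (Pi.single j Complex.I) * fderiv ℝ g α (Pi.single j 1))

/-! ### The Gelfand–Dikij bracket -/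

/-- The projection to the anti-Hermitian matrices along the lower triangular matrices with real
diagonal. -/
def piA {n : ℕ} (X : Matrix (Fin n) (Fin n) ℂ) : Matrix (Fin n) (Fin n) ℂ :=
  Matrix.of fun i j =>
    if i < j then X i j
    else if i = j then ((X i i).im : ℂ) * Complex.I
    else -conj (X j i)

/-- The projection to the lower triangular matrices with real diagonal along the anti-Hermitian
matrices. -/
def piL {n : ℕ} (X : Matrix (Fin n) (Fin n) ℂ) : Matrix (Fin n) (Fin n) ℂ :=
  X - piA X

theorem piA_antiHermitian {n : ℕ} (X : Matrix (Fin n) (Fin n) ℂ) :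
    (piA X).conjTranspose = -piA X := by
  ext i j
  simp only [piA, Matrix.conjTranspose_apply, Matrix.of_apply, Matrix.neg_apply]
  rcases lt_trichotomy i j with h | h | h
  · simp [h, h.not_gt, h.ne']
  · subst h; simp
  · simp [h, h.not_gt, h.ne']

theorem piL_lower {n : ℕ} (X : Matrix (Fin n) (Fin n) ℂ) :
    (∀ i j, i < j → piL X i j = 0) ∧ ∀ i, (piL X i i).im = 0 := by
  refine ⟨fun i j h => ?_, fun i => ?_⟩ <;> simp [piL, piA, *]

/-- `R = π_𝔩 - π_𝔞`. -/
def R {n : ℕ} (X : Matrix (Fin n) (Fin n) ℂ) : Matrix (Fin n) (Fin n) ℂ :=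
  piL X - piA X

/-- The pairing `⟨X, Y⟩ = Im tr (X Y)`. -/
def pairing {n : ℕ} (X Y : Matrix (Fin n) (Fin n) ℂ) : ℝ :=
  (X * Y).trace.im

/-- The gradient of `φ` at `B` with respect to `pairing`:
`[∇φ]_{kl} = ∂φ/∂v_{lk} + i ∂φ/∂u_{lk}`, where `b_{kl} = u_{kl} + i v_{kl}` are the entries
of `B`. -/
def grad {n : ℕ} (φ : Matrix (Fin n) (Fin n) ℂ → ℝ) (B : Matrix (Fin n) (Fin n) ℂ) :
    Matrix (Fin n) (Fin n) ℂ :=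
  Matrix.of fun k l =>
    (fderiv ℝ φ B (Matrix.single l k Complex.I) : ℂ)
      + (fderiv ℝ φ B (Matrix.single l k 1) : ℂ) * Complex.I

/-- With `X = ∇φ` and `Y = ∇ψ` at `B`, `{φ, ψ} = ½⟨R(XB), YB⟩ - ½⟨R(BX), BY⟩`. -/
def gdBracket {n : ℕ} (φ ψ : Matrix (Fin n) (Fin n) ℂ → ℝ)
    (B : Matrix (Fin n) (Fin n) ℂ) : ℝ :=
  1 / 2 * pairing (R (grad φ B * B)) (grad ψ B * B)
    - 1 / 2 * pairing (R (B * grad φ B)) (B * grad ψ B)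

/-- `φ` agrees with `F` at all points of `S` near `B`: locally, `φ` extends the function `F`
on `S` to the space of all matrices. -/
def ExtendsNear {n : ℕ} (S : Set (Matrix (Fin n) (Fin n) ℂ))
    (F φ : Matrix (Fin n) (Fin n) ℂ → ℝ) (B : Matrix (Fin n) (Fin n) ℂ) : Prop :=
  ∀ᶠ X in 𝓝[S] B, φ X = F X

end

end CMV

/- Both brackets are the same Poisson structure: the Gelfand–Dikij structure is multiplicative, the
Hamiltonian vector field of each block-diagonal factor is computed block by block, and so the
coordinates `α` carry the Gelfand–Dikij bracket to the Ablowitz–Ladik one.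

For the Ablowitz–Ladik bracket, let `f` be the Schur function with Schur parameters
`α₀, …, α_{n-1}`. An induction along the Schur algorithm gives
`{f(z), f(w)} = -2i (f(z) - f(w)) (z f(z) - w f(w)) / (z - w)`. The Cauchy transform of the spectral
measure, `F(z) = ∑ μ_j / (ζ_j - z)`, equals `f(z) / (1 - z f(z))`, and the residues of
`{F(z), F(w)}` at `z = ζ_j`, `w = ζ_k` give
`{log μ_j, log μ_k} = 2 cot ((θ_j - θ_k) / 2) + κ_j - κ_k`. The coboundary `κ` drops out of the
bracket of the two log-ratios. -/

namespace CMV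

noncomputable section

/-! ### The Ablowitz–Ladik form -/

theorem rho_sq {z : ℂ} (hz : ‖z‖ ≤ 1) : (rho z : ℂ) ^ 2 = 1 - z * conj z := by
  have h : rho z ^ 2 = 1 - ‖z‖ ^ 2 := Real.sq_sqrt (by nlinarith [norm_nonneg z])
  rw [← Complex.ofReal_pow, h, Complex.mul_conj']
  push_cast
  rfl

theorem rho_pos {z : ℂ} (hz : ‖z‖ < 1) : 0 < rho z :=
  Real.sqrt_pos.2 (by nlinarith [norm_nonneg z])

theorem hasFDerivAt_div {𝕜 𝕜' E : Type*} [NontriviallyNormedField 𝕜] [NontriviallyNormedField 𝕜']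
    [NormedAlgebra 𝕜 𝕜'] [NormedAddCommGroup E] [NormedSpace 𝕜 E] {f g : E → 𝕜'}
    {f' g' : E →L[𝕜] 𝕜'} {x : E} (hf : HasFDerivAt f f' x) (hg : HasFDerivAt g g' x)
    (hx : g x ≠ 0) :
    HasFDerivAt (fun y => f y / g y) ((1 / g x) • f' - (f x / g x ^ 2) • g') x := by
  have hinv : HasFDerivAt (fun y => (g y)⁻¹) _ x :=
    ((hasDerivAt_inv hx).hasFDerivAt.restrictScalars 𝕜).comp x hg
  simp only [div_eq_mul_inv]
  refine (hf.mul hinv).congr_fderiv ?_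
  ext v
  simp
  ring

section AlForm

variable {m : ℕ} (α : Fin m → ℂ)

/-- The value of a complex-valued differential on a tangent vector, as a functional of the
differential. -/
def evalAt (v : Fin m → ℂ) : ((Fin m → ℂ) →L[ℝ] ℂ) →ₗ[ℂ] ℂ where
  toFun D := D v
  map_add' _ _ := rfl
  map_smul' _ _ := rfl

/-- The Poisson tensor of the Ablowitz–Ladik bracket at `α`, extended complex bilinearly to
complex-valued differentials. -/
def alForm : ((Fin m → ℂ) →L[ℝ] ℂ) →ₗ[ℂ] ((Fin m → ℂ) →L[ℝ] ℂ) →ₗ[ℂ] ℂ :=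
  ∑ j, (rho (α j) : ℂ) ^ 2 •
    ((LinearMap.mul ℂ ℂ).compl₁₂ (evalAt (Pi.single j 1)) (evalAt (Pi.single j Complex.I))
      - (LinearMap.mul ℂ ℂ).compl₁₂ (evalAt (Pi.single j Complex.I)) (evalAt (Pi.single j 1)))

theorem alForm_apply (V W : (Fin m → ℂ) →L[ℝ] ℂ) :
    alForm α V W = ∑ j, (rho (α j) : ℂ) ^ 2 *
      (V (Pi.single j 1) * W (Pi.single j Complex.I)
        - V (Pi.single j Complex.I) * W (Pi.single j 1)) := by
  simp [alForm, evalAt, LinearMap.sum_apply]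

theorem alForm_swap (V W : (Fin m → ℂ) →L[ℝ] ℂ) : alForm α W V = -alForm α V W := by
  rw [alForm_apply, alForm_apply, ← Finset.sum_neg_distrib]
  exact Finset.sum_congr rfl fun j _ => by ring

theorem alForm_self (V : (Fin m → ℂ) →L[ℝ] ℂ) : alForm α V V = 0 :=
  self_eq_neg.1 (alForm_swap α V V)

/-- The differential `dα_k`. -/
def dcoord (k : Fin m) : (Fin m → ℂ) →L[ℝ] ℂ := ContinuousLinearMap.proj k

/-- The differential `d(conj α_k)`. -/
def dcoordConj (k : Fin m) : (Fin m → ℂ) →L[ℝ] ℂ := (Complex.conjCLE : ℂ →L[ℝ] ℂ).comp (dcoord k)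

theorem dcoord_single (k j : Fin m) (v : ℂ) :
    dcoord k (Pi.single j v) = if k = j then v else 0 := by
  simp [dcoord, Pi.single_apply]

theorem dcoordConj_single (k j : Fin m) (v : ℂ) :
    dcoordConj k (Pi.single j v) = if k = j then conj v else 0 := by
  rw [dcoordConj, ContinuousLinearMap.comp_apply, dcoord_single]
  split_ifs <;> simp

theorem alForm_dcoord_dcoordConj (k : Fin m) :
    alForm α (dcoord k) (dcoordConj k) = -2 * Complex.I * (rho (α k) : ℂ) ^ 2 := by
  rw [alForm_apply, Finset.sum_eq_single k]
  · simp only [dcoord_single, dcoordConj_single, if_true, Complex.conj_I, map_one]; ring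
  · intro j _ hj
    simp only [dcoord_single, dcoordConj_single, if_neg hj.symm]; ring
  · simp

theorem alForm_eq_zero {V W : (Fin m → ℂ) →L[ℝ] ℂ}
    (h : ∀ j, (∀ v, V (Pi.single j v) = 0) ∨ ∀ v, W (Pi.single j v) = 0) :
    alForm α V W = 0 := by
  rw [alForm_apply]
  refine Finset.sum_eq_zero fun j _ => ?_
  rcases h j with h | h <;> simp [h]

theorem alForm_dcoord_eq_zero {k : Fin m} {D : (Fin m → ℂ) →L[ℝ] ℂ}
    (hD : ∀ v, D (Pi.single k v) = 0) :
    alForm α (dcoord k) D = 0 ∧ alForm α (dcoordConj k) D = 0 := by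
  constructor <;> refine alForm_eq_zero α fun j => ?_ <;> rcases eq_or_ne k j with rfl | h
  · exact Or.inr hD
  · exact Or.inl fun v => by rw [dcoord_single, if_neg h]
  · exact Or.inr hD
  · exact Or.inl fun v => by rw [dcoordConj_single, if_neg h]

theorem alForm_add_smul {k : Fin m} {D D' : (Fin m → ℂ) →L[ℝ] ℂ}
    (hD : ∀ v, D (Pi.single k v) = 0) (hD' : ∀ v, D' (Pi.single k v) = 0) (p q r p' q' r' : ℂ) :
    alForm α (p • dcoord k + q • dcoordConj k + r • D) (p' • dcoord k + q' • dcoordConj k + r' • D')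
      = -2 * Complex.I * (rho (α k) : ℂ) ^ 2 * (p * q' - q * p') + r * r' * alForm α D D' := by
  obtain ⟨h, hc⟩ := alForm_dcoord_eq_zero α hD
  obtain ⟨h', hc'⟩ := alForm_dcoord_eq_zero α hD'
  simp only [map_add, map_smul, LinearMap.add_apply, LinearMap.smul_apply, smul_eq_mul,
    alForm_self, h', hc', alForm_swap α (dcoord k) (dcoordConj k), alForm_swap α (dcoord k) D,
    alForm_swap α (dcoordConj k) D, h, hc, alForm_dcoord_dcoordConj]
  ring

end AlForm

/-! ### Schur functions and their Ablowitz–Ladik brackets -/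

/-- One step of the inverse Schur algorithm, which prepends the Schur parameter `γ` to a Schur
function with value `g` at `z`. -/
def schurStep (γ z g : ℂ) : ℂ := (γ + z * g) / (1 + conj γ * z * g)

section SchurStep

variable {γ z g : ℂ}

theorem schurStep_den_ne_zero (hγ : ‖γ‖ < 1) (hz : ‖z‖ < 1) (hg : ‖g‖ ≤ 1) :
    1 + conj γ * z * g ≠ 0 := by
  intro h
  have hnorm : ‖γ‖ * ‖z‖ * ‖g‖ = 1 := by
    simpa using congrArg norm (eq_neg_of_add_eq_zero_right h)
  have hγz : ‖γ‖ * ‖z‖ < 1 := by nlinarith [norm_nonneg γ, norm_nonneg z]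
  nlinarith [mul_nonneg (norm_nonneg γ) (norm_nonneg z), norm_nonneg g]

theorem norm_sq_one_add_conj_mul_sub (γ h : ℂ) :
    ‖1 + conj γ * h‖ ^ 2 - ‖γ + h‖ ^ 2 = (1 - ‖γ‖ ^ 2) * (1 - ‖h‖ ^ 2) := by
  simp only [← Complex.normSq_eq_norm_sq, Complex.normSq_apply, Complex.add_re, Complex.add_im,
    Complex.mul_re, Complex.mul_im, Complex.conj_re, Complex.conj_im, Complex.one_re,
    Complex.one_im]
  ring

theorem norm_schurStep_le (hγ : ‖γ‖ < 1) (hz : ‖z‖ < 1) (hg : ‖g‖ ≤ 1) :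
    ‖schurStep γ z g‖ ≤ 1 := by
  have hzg : ‖z * g‖ ≤ 1 := by
    rw [norm_mul]
    exact mul_le_one₀ hz.le (norm_nonneg g) hg
  have hsub : 0 ≤ ‖1 + conj γ * (z * g)‖ ^ 2 - ‖γ + z * g‖ ^ 2 := by
    rw [norm_sq_one_add_conj_mul_sub]
    exact mul_nonneg (by nlinarith [norm_nonneg γ]) (by nlinarith [norm_nonneg (z * g)])
  rw [schurStep, norm_div, div_le_one (norm_pos_iff.2 (schurStep_den_ne_zero hγ hz hg)), mul_assoc]
  exact le_of_sq_le_sq (sub_nonneg.1 hsub) (norm_nonneg _)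

theorem hasFDerivAt_schurStep {m : ℕ} {α : Fin m → ℂ} (k : Fin m) {z : ℂ}
    {g : (Fin m → ℂ) → ℂ} {D : (Fin m → ℂ) →L[ℝ] ℂ} (hα : ‖α k‖ ≤ 1) (hg : HasFDerivAt g D α)
    (hd : 1 + conj (α k) * z * g α ≠ 0) :
    HasFDerivAt (fun β => schurStep (β k) z (g β))
      ((1 / (1 + conj (α k) * z * g α)) • dcoord k
        + (-(z * g α * (α k + z * g α)) / (1 + conj (α k) * z * g α) ^ 2) • dcoordConj k
        + (z * (rho (α k) : ℂ) ^ 2 / (1 + conj (α k) * z * g α) ^ 2) • D) α := by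
  have hcoord : HasFDerivAt (fun β : Fin m → ℂ => β k) (dcoord k) α := (dcoord k).hasFDerivAt
  have hconj : HasFDerivAt (fun β : Fin m → ℂ => conj (β k)) (dcoordConj k) α :=
    (dcoordConj k).hasFDerivAt
  refine (hasFDerivAt_div (hcoord.add (hg.const_mul z))
    (((hconj.mul_const z).mul hg).const_add 1) hd).congr_fderiv ?_
  ext v
  rw [rho_sq hα]
  simp
  field_simp
  ring

/-- The Ablowitz–Ladik bracket of the values `g`, `h` of a Schur function at `z`, `w`. -/
def schurBracket (z w g h : ℂ) : ℂ :=
  -2 * Complex.I * ((g - h) * (z * g - w * h) / (z - w))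

theorem schurBracket_schurStep {w h : ℂ} (hγ : ‖γ‖ ≤ 1) (hzw : z ≠ w)
    (hd : 1 + conj γ * z * g ≠ 0) (he : 1 + conj γ * w * h ≠ 0) :
    schurBracket z w (schurStep γ z g) (schurStep γ w h)
      = -2 * Complex.I * (rho γ : ℂ) ^ 2
          * (1 / (1 + conj γ * z * g) * (-(w * h * (γ + w * h)) / (1 + conj γ * w * h) ^ 2)
            - -(z * g * (γ + z * g)) / (1 + conj γ * z * g) ^ 2 * (1 / (1 + conj γ * w * h)))
        + z * (rho γ : ℂ) ^ 2 / (1 + conj γ * z * g) ^ 2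
          * (w * (rho γ : ℂ) ^ 2 / (1 + conj γ * w * h) ^ 2) * schurBracket z w g h := by
  have hzw' : z - w ≠ 0 := sub_ne_zero.2 hzw
  rw [rho_sq hγ, schurBracket, schurBracket, schurStep, schurStep]
  generalize conj γ = γ' at hd he ⊢
  have hd' : 1 + z * g * γ' ≠ 0 := by convert hd using 1; ring
  field_simp
  ring

end SchurStep

section Schur

variable {m : ℕ} {a z : ℂ} {α : Fin m → ℂ}

/-- The value at `z` of the Schur function with Schur parameters `α_k, …, α_{m-1}, a`. -/
def schur (a z : ℂ) (α : Fin m → ℂ) : Fin (m + 1) → ℂ :=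
  Fin.reverseInduction a fun k g => schurStep (α k) z g

@[simp]
theorem schur_last : schur a z α (Fin.last m) = a := by simp [schur]

theorem schur_castSucc (k : Fin m) :
    schur a z α k.castSucc = schurStep (α k) z (schur a z α k.succ) := by
  simp [schur]

theorem norm_schur_le (ha : ‖a‖ ≤ 1) (hz : ‖z‖ < 1) (hα : ∀ k, ‖α k‖ < 1) (k : Fin (m + 1)) :
    ‖schur a z α k‖ ≤ 1 := by
  induction k using Fin.reverseInduction with
  | last => rwa [schur_last]
  | cast k ih => rw [schur_castSucc]; exact norm_schurStep_le (hα k) hz ih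

theorem schur_den_ne_zero (ha : ‖a‖ ≤ 1) (hz : ‖z‖ < 1) (hα : ∀ k, ‖α k‖ < 1) (k : Fin m) :
    1 + conj (α k) * z * schur a z α k.succ ≠ 0 :=
  schurStep_den_ne_zero (hα k) hz (norm_schur_le ha hz hα k.succ)

theorem differentiableAt_schur (ha : ‖a‖ ≤ 1) (hz : ‖z‖ < 1) (hα : ∀ k, ‖α k‖ < 1)
    (k : Fin (m + 1)) : DifferentiableAt ℝ (fun β => schur a z β k) α := by
  induction k using Fin.reverseInduction with
  | last => simp
  | cast k ih =>
    simp only [schur_castSucc]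
    exact (hasFDerivAt_schurStep k (hα k).le ih.hasFDerivAt
      (schur_den_ne_zero ha hz hα k)).differentiableAt

theorem fderiv_schur_castSucc (ha : ‖a‖ ≤ 1) (hz : ‖z‖ < 1) (hα : ∀ k, ‖α k‖ < 1) (k : Fin m) :
    fderiv ℝ (fun β => schur a z β k.castSucc) α
      = (1 / (1 + conj (α k) * z * schur a z α k.succ)) • dcoord k
        + (-(z * schur a z α k.succ * (α k + z * schur a z α k.succ))
          / (1 + conj (α k) * z * schur a z α k.succ) ^ 2) • dcoordConj k
        + (z * (rho (α k) : ℂ) ^ 2 / (1 + conj (α k) * z * schur a z α k.succ) ^ 2)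
          • fderiv ℝ (fun β => schur a z β k.succ) α := by
  simp only [schur_castSucc]
  exact (hasFDerivAt_schurStep k (hα k).le (differentiableAt_schur ha hz hα k.succ).hasFDerivAt
    (schur_den_ne_zero ha hz hα k)).fderiv

theorem fderiv_schur_single_of_lt (ha : ‖a‖ ≤ 1) (hz : ‖z‖ < 1) (hα : ∀ k, ‖α k‖ < 1)
    {k : Fin (m + 1)} {j : Fin m} (hjk : j.castSucc < k) (v : ℂ) :
    fderiv ℝ (fun β => schur a z β k) α (Pi.single j v) = 0 := by
  induction k using Fin.reverseInduction with
  | last => simp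
  | cast k ih =>
    have hkj : k ≠ j := fun h => (Fin.castSucc_lt_castSucc_iff.1 hjk).ne' h
    rw [fderiv_schur_castSucc ha hz hα k]
    simp [dcoord_single, dcoordConj_single, hkj, ih (hjk.trans k.castSucc_lt_succ)]

theorem alForm_schur (ha : ‖a‖ ≤ 1) (hα : ∀ k, ‖α k‖ < 1) {w : ℂ} (hz : ‖z‖ < 1) (hw : ‖w‖ < 1)
    (hzw : z ≠ w) (k : Fin (m + 1)) :
    alForm α (fderiv ℝ (fun β => schur a z β k) α) (fderiv ℝ (fun β => schur a w β k) α)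
      = schurBracket z w (schur a z α k) (schur a w α k) := by
  induction k using Fin.reverseInduction with
  | last => simp [schurBracket]
  | cast k ih =>
    have hoff : ∀ {z}, ‖z‖ < 1 → ∀ v,
        fderiv ℝ (fun β => schur a z β k.succ) α (Pi.single k v) = 0 := fun hz =>
      fderiv_schur_single_of_lt ha hz hα k.castSucc_lt_succ
    rw [fderiv_schur_castSucc ha hz hα, fderiv_schur_castSucc ha hw hα,
      alForm_add_smul α (hoff hz) (hoff hw), ih, schur_castSucc, schur_castSucc,
      schurBracket_schurStep (hα k).le hzw (schur_den_ne_zero ha hz hα k)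
        (schur_den_ne_zero ha hw hα k)]

end Schur

/-! ### Poles of Cauchy transforms -/

theorem hasDerivAt_unique_of_eqOn {𝕜 F : Type*} [NontriviallyNormedField 𝕜] [NormedAddCommGroup F]
    [NormedSpace 𝕜 F] {f g : 𝕜 → F} {f' g' : F} {s : Set 𝕜} {x : 𝕜} (hs : UniqueDiffWithinAt 𝕜 s x)
    (hf : HasDerivAt f f' x) (hg : HasDerivAt g g' x) (h : Set.EqOn f g s) : f' = g' := by
  have hx : f x = g x :=
    have := mem_closure_iff_nhdsWithin_neBot.1 hs.mem_closure
    tendsto_nhds_unique_of_eventuallyEq hf.hasDerivWithinAt.continuousWithinAt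
      hg.hasDerivWithinAt.continuousWithinAt h.eventuallyEq_nhdsWithin
  exact hs.eq_deriv s hf.hasDerivWithinAt (hg.hasDerivWithinAt.congr h hx)

theorem uniqueDiffWithinAt_unitBall {z : ℂ} (hz : ‖z‖ = 1) :
    UniqueDiffWithinAt ℂ (Metric.ball 0 1) z := by
  refine uniqueDiffWithinAt_convex_of_isRCLikeNormedField (convex_ball 0 1) ?_ ?_
  · exact ⟨0, by simp [Metric.isOpen_ball.interior_eq]⟩
  · rw [closure_ball 0 one_ne_zero]
    simp [hz]

theorem sub_ne_zero_of_norm_lt_one {u w : ℂ} (hu : ‖u‖ = 1) (hw : ‖w‖ < 1) : u - w ≠ 0 :=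
  sub_ne_zero.2 fun h => (h ▸ hw).ne hu

theorem hasDerivAt_add_sub_mul {H : ℂ → ℂ} {a : ℂ} (hH : DifferentiableAt ℂ H a) (c : ℂ) :
    HasDerivAt (fun z => c + (a - z) * H z) (-H a) a := by
  refine ((((hasDerivAt_id a).const_sub a).mul hH.hasDerivAt).const_add c).congr_deriv ?_
  simp

section Cauchy

variable {ι : Type*} [Fintype ι]

/-- The Cauchy transform `∑ μ_l / (ζ_l - z)` of the measure with masses `μ_l` at `ζ_l`. -/
def cauchy (μ ζ : ι → ℂ) (z : ℂ) : ℂ := ∑ l, μ l / (ζ l - z)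

/-- The differential of `cauchy μ ζ z` in terms of the differentials of `μ` and `ζ`. -/
def dcauchy {V : Type*} [AddCommGroup V] [Module ℂ V] (μ ζ : ι → ℂ) (dμ dζ : ι → V) (z : ℂ) : V :=
  ∑ l, ((1 / (ζ l - z)) • dμ l - (μ l / (ζ l - z) ^ 2) • dζ l)

section Extraction

variable {V : Type*} [AddCommGroup V] [Module ℂ V] {μ ζ : ι → ℂ} {dμ dζ : ι → V}

theorem sq_mul_dcauchy [DecidableEq ι] (Λ : V →ₗ[ℂ] ℂ) {j : ι} {z : ℂ} (hz : ζ j - z ≠ 0) :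
    (ζ j - z) ^ 2 * Λ (dcauchy μ ζ dμ dζ z)
      = -(μ j * Λ (dζ j)) + (ζ j - z) * (Λ (dμ j) + (ζ j - z) * ∑ l ∈ Finset.univ.erase j,
        (Λ (dμ l) / (ζ l - z) - μ l * Λ (dζ l) / (ζ l - z) ^ 2)) := by
  have hterm : ∀ l, Λ ((1 / (ζ l - z)) • dμ l - (μ l / (ζ l - z) ^ 2) • dζ l)
      = Λ (dμ l) / (ζ l - z) - μ l * Λ (dζ l) / (ζ l - z) ^ 2 := fun l => by
    simp only [map_sub, map_smul, smul_eq_mul]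
    ring
  rw [dcauchy, map_sum, Finset.sum_congr rfl fun l _ => hterm l,
    ← Finset.add_sum_erase _ _ (Finset.mem_univ j)]
  field_simp
  ring

/-- `Λ (dcauchy μ ζ dμ dζ z)` has a double pole at `z = ζ_j`, and `-Λ (dμ j)` is its residue. -/
theorem apply_eq_of_dcauchy (Λ : V →ₗ[ℂ] ℂ) (hζ : Function.Injective ζ) {j : ι} (hj : ‖ζ j‖ = 1)
    {g : ℂ → ℂ} {g' : ℂ} (hg : HasDerivAt g g' (ζ j))
    (h : ∀ z, ‖z‖ < 1 → (ζ j - z) ^ 2 * Λ (dcauchy μ ζ dμ dζ z) = g z) :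
    Λ (dμ j) = -g' := by
  classical
  have hreg : DifferentiableAt ℂ (fun z => ∑ l ∈ Finset.univ.erase j,
      (Λ (dμ l) / (ζ l - z) - μ l * Λ (dζ l) / (ζ l - z) ^ 2)) (ζ j) := by
    refine DifferentiableAt.fun_sum fun l hl => ?_
    have hne : ζ l - ζ j ≠ 0 := sub_ne_zero.2 (hζ.ne (Finset.ne_of_mem_erase hl))
    exact ((differentiableAt_const _).div (by fun_prop) hne).sub
      ((differentiableAt_const _).div (by fun_prop) (pow_ne_zero 2 hne))
  have hpole := hasDerivAt_add_sub_mul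
    (((differentiableAt_const (Λ (dμ j))).add (((differentiableAt_const (ζ j)).sub
      differentiableAt_id).mul hreg))) (-(μ j * Λ (dζ j)))
  have hderiv := hasDerivAt_unique_of_eqOn (uniqueDiffWithinAt_unitBall hj) hpole hg fun z hz => by
    have hz : ‖z‖ < 1 := mem_ball_zero_iff.1 hz
    exact (sq_mul_dcauchy Λ (sub_ne_zero_of_norm_lt_one hj hz)).symm.trans (h z hz)
  simp [← hderiv]

end Extraction

variable [DecidableEq ι]

/-- The part of the Cauchy transform that is regular at `ζ_j`. -/
def cauchyReg (μ ζ : ι → ℂ) (j : ι) (z : ℂ) : ℂ := ∑ l ∈ Finset.univ.erase j, μ l / (ζ l - z)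

/-- `2 ζ_j A_j - μ_j`, where `A_j` is the value of the regular part at `ζ_j`. In the brackets of the
`log μ_j` these terms form a coboundary. -/
def cauchyGauge (μ ζ : ι → ℂ) (j : ι) : ℂ := 2 * ζ j * cauchyReg μ ζ j (ζ j) - μ j

theorem sub_mul_cauchy (μ ζ : ι → ℂ) (j : ι) {z : ℂ} (hz : ζ j - z ≠ 0) :
    (ζ j - z) * cauchy μ ζ z = μ j + (ζ j - z) * cauchyReg μ ζ j z := by
  rw [cauchy, ← Finset.add_sum_erase _ _ (Finset.mem_univ j), mul_add, mul_div_cancel₀ _ hz,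
    cauchyReg]

theorem hasDerivAt_add_sub_mul_cauchyReg (μ : ι → ℂ) {ζ : ι → ℂ} (hζ : Function.Injective ζ)
    (j : ι) :
    HasDerivAt (fun z => μ j + (ζ j - z) * cauchyReg μ ζ j z) (-cauchyReg μ ζ j (ζ j)) (ζ j) := by
  refine hasDerivAt_add_sub_mul (DifferentiableAt.fun_sum fun l hl => ?_) (μ j)
  have hne : ζ l - ζ j ≠ 0 := sub_ne_zero.2 (hζ.ne (Finset.ne_of_mem_erase hl))
  exact (differentiableAt_const _).div (by fun_prop) hne

/-- The Ablowitz–Ladik bracket of the values `g`, `h` of the Cauchy transform at `z`, `w`. -/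
def cauchyBracket (z w g h : ℂ) : ℂ :=
  -2 * Complex.I * ((z * g - w * h) * ((g - h) / (z - w) - g * h))

variable {V : Type*} [AddCommGroup V] [Module ℂ V] {B : V →ₗ[ℂ] V →ₗ[ℂ] ℂ} {μ ζ : ι → ℂ}
  {dμ dζ : ι → V}

theorem form_dmu_dcauchy (hζ : Function.Injective ζ) (hζ₁ : ∀ l, ‖ζ l‖ = 1)
    (hB : ∀ z w, ‖z‖ < 1 → ‖w‖ < 1 → B (dcauchy μ ζ dμ dζ z) (dcauchy μ ζ dμ dζ w)
      = cauchyBracket z w (cauchy μ ζ z) (cauchy μ ζ w))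
    (j : ι) {w : ℂ} (hw : ‖w‖ < 1) :
    B (dμ j) (dcauchy μ ζ dμ dζ w)
      = -2 * Complex.I * ((-μ j + ζ j * cauchyReg μ ζ j (ζ j) - w * cauchy μ ζ w)
          * (μ j / (ζ j - w) - μ j * cauchy μ ζ w)
        + ζ j * μ j * ((cauchyReg μ ζ j (ζ j) - cauchy μ ζ w) / (ζ j - w) + μ j / (ζ j - w) ^ 2
          - cauchyReg μ ζ j (ζ j) * cauchy μ ζ w)) := by
  have hjw := sub_ne_zero_of_norm_lt_one (hζ₁ j) hw
  have hU := hasDerivAt_add_sub_mul_cauchyReg μ hζ j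
  generalize cauchyReg μ ζ j (ζ j) = A at hU ⊢
  generalize hG : cauchy μ ζ w = G
  have hz := hasDerivAt_id (ζ j)
  have ht : HasDerivAt (fun z => ζ j - z) (-1) (ζ j) := hz.const_sub (ζ j)
  have hg := (((hz.mul hU).sub (ht.mul_const (w * G))).mul
    (((hU.sub (ht.mul_const G)).div (hz.sub_const w) hjw).sub (hU.mul_const G))).const_mul
      (-2 * Complex.I)
  rw [← LinearMap.flip_apply, apply_eq_of_dcauchy (B.flip (dcauchy μ ζ dμ dζ w)) hζ (hζ₁ j) hg]
  · simp only [Pi.mul_apply, Pi.sub_apply, Pi.div_apply, id, sub_self, zero_mul, add_zero]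
    field_simp
    ring
  · intro z hz
    simp only [Pi.mul_apply, Pi.sub_apply, Pi.div_apply, id]
    rw [LinearMap.flip_apply, hB z w hz hw, hG, cauchyBracket,
      ← sub_mul_cauchy μ ζ j (sub_ne_zero_of_norm_lt_one (hζ₁ j) hz)]
    ring

theorem form_dmu_dmu (hζ : Function.Injective ζ) (hζ₁ : ∀ l, ‖ζ l‖ = 1)
    (hB : ∀ z w, ‖z‖ < 1 → ‖w‖ < 1 → B (dcauchy μ ζ dμ dζ z) (dcauchy μ ζ dμ dζ w)
      = cauchyBracket z w (cauchy μ ζ z) (cauchy μ ζ w))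
    {j k : ι} (hjk : j ≠ k) :
    B (dμ j) (dμ k) = 2 * Complex.I * μ j * μ k * ((ζ j + ζ k) / (ζ j - ζ k)
      + cauchyGauge μ ζ j - cauchyGauge μ ζ k) := by
  have hjk' : ζ j - ζ k ≠ 0 := sub_ne_zero.2 (hζ.ne hjk)
  have hform := fun w hw => form_dmu_dcauchy hζ hζ₁ hB j (w := w) hw
  have hU := hasDerivAt_add_sub_mul_cauchyReg μ hζ k
  rw [cauchyGauge, cauchyGauge]
  generalize cauchyReg μ ζ j (ζ j) = A at hform ⊢
  generalize cauchyReg μ ζ k (ζ k) = A' at hU ⊢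
  have hw := hasDerivAt_id (ζ k)
  have ht : HasDerivAt (fun w => ζ k - w) (-1) (ζ k) := hw.const_sub (ζ k)
  have hd : HasDerivAt (fun w => ζ j - w) (-1) (ζ k) := hw.const_sub (ζ j)
  have hP := (ht.mul_const (-μ j + ζ j * A)).sub (hw.mul hU)
  have hQ := ((ht.mul_const (μ j)).div hd hjk').sub (hU.const_mul (μ j))
  have hS := ((((ht.pow 2).mul_const A).sub (ht.mul hU)).div hd hjk').add
    (((ht.pow 2).mul_const (μ j)).div (hd.pow 2) (pow_ne_zero 2 hjk'))
  have hg := ((hP.mul hQ).add ((hS.sub ((ht.mul hU).const_mul A)).const_mul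
    (ζ j * μ j))).const_mul (-2 * Complex.I)
  rw [apply_eq_of_dcauchy (B (dμ j)) hζ (hζ₁ k) hg]
  · simp only [Pi.mul_apply, Pi.sub_apply, Pi.div_apply, Pi.pow_apply, id, sub_self, zero_mul,
      add_zero]
    field_simp
    ring
  · intro w hw
    simp only [Pi.mul_apply, Pi.sub_apply, Pi.div_apply, Pi.pow_apply, Pi.add_apply, id]
    rw [hform w hw, ← sub_mul_cauchy μ ζ k (sub_ne_zero_of_norm_lt_one (hζ₁ k) hw)]
    ring

end Cauchy

open Matrix

/-! ### The block factors of a CMV matrix -/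

theorem rho_conj (z : ℂ) : rho (conj z) = rho z := by simp [rho]

section Factor

variable {m p : ℕ}

theorem eq_of_blocks {β : Type*} (hp : p < 2) {x y : Fin (m + 1) → β}
    (hcastSucc : ∀ k : Fin m, k.val % 2 = p → x k.castSucc = y k.castSucc)
    (hsucc : ∀ k : Fin m, k.val % 2 = p → x k.succ = y k.succ)
    (hlast : m % 2 = p → x (Fin.last m) = y (Fin.last m)) (hzero : p ≠ 0 → x 0 = y 0) :
    x = y := by
  ext i
  by_cases hi : i.val % 2 = p
  · induction i using Fin.lastCases with
    | last => exact hlast hi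
    | cast k => exact hcastSucc k hi
  · induction i using Fin.cases with
    | zero => exact hzero (Ne.symm hi)
    | succ k => exact hsucc k (by rw [Fin.val_succ] at hi; omega)

variable (A x : Fin (m + 1) → ℂ)

theorem factor_mulVec_castSucc {k : Fin m} (hk : k.val % 2 = p) :
    (factor p A *ᵥ x) k.castSucc
      = conj (A k.castSucc) * x k.castSucc + rho (A k.castSucc) * x k.succ := by
  rw [mulVec, dotProduct, Finset.sum_eq_add k.castSucc k.succ k.castSucc_lt_succ.ne]
  · simp [factor, hk, k.castSucc_lt_succ.ne]
  · rintro c - ⟨hc, hc'⟩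
    have hnext : k.val + 1 ≠ c.val := fun h => hc' (Fin.ext h.symm)
    have hprev : ¬ (c.val + 1 = k.val ∧ c.val % 2 = p) := by omega
    simp [factor, hc.symm, hnext, hprev]
  · simp
  · simp

theorem factor_mulVec_succ {k : Fin m} (hk : k.val % 2 = p) :
    (factor p A *ᵥ x) k.succ = rho (A k.castSucc) * x k.castSucc - A k.castSucc * x k.succ := by
  have hk' : (k.val + 1) % 2 ≠ p := by omega
  rw [mulVec, dotProduct, Finset.sum_eq_add k.castSucc k.succ k.castSucc_lt_succ.ne]
  · have hpred : A ⟨k.val, by omega⟩ = A k.castSucc := rfl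
    simp [factor, hk, hk', k.castSucc_lt_succ.ne', sub_eq_add_neg, hpred]
  · rintro c - ⟨hc, hc'⟩
    have hprev : c.val ≠ k.val := fun h => hc (Fin.ext h)
    simp [factor, hc'.symm, hk', hprev]
  · simp
  · simp

theorem factor_mulVec_last (hm : m % 2 = p) :
    (factor p A *ᵥ x) (Fin.last m) = conj (A (Fin.last m)) * x (Fin.last m) := by
  rw [mulVec, dotProduct, Finset.sum_eq_single (Fin.last m)]
  · simp [factor, hm]
  · intro c _ hc
    have hnext : ¬ m + 1 = c.val := by omega
    have hprev : ¬ (c.val + 1 = m ∧ c.val % 2 = p) := by omega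
    simp [factor, hc.symm, hnext, hprev]
  · simp

theorem factor_mulVec_zero (hp : p ≠ 0) : (factor p A *ᵥ x) 0 = x 0 := by
  rw [mulVec, dotProduct, Finset.sum_eq_single 0]
  · simp [factor, hp.symm]
  · intro c _ hc
    simp [factor, hc.symm, hp.symm]
  · simp

theorem factor_mulVec_castSucc_of_eq_zero {k : Fin m} (hx : ∀ j ≤ k.castSucc, x j = 0) :
    (factor p A *ᵥ x) k.castSucc = if k.val % 2 = p then rho (A k.castSucc) * x k.succ else 0 := by
  rw [mulVec, dotProduct, Finset.sum_eq_single k.succ]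
  · have hprev : k.val + 1 + 1 ≠ k.val := by omega
    by_cases hk : k.val % 2 = p <;> simp [factor, hk, hprev, k.castSucc_lt_succ.ne]
  · intro c _ hc
    rcases le_or_gt c k.castSucc with hck | hck
    · rw [hx c hck, mul_zero]
    · have hnext : k.val + 1 ≠ c.val := fun h => hc (Fin.ext h.symm)
      have hprev : c.val + 1 ≠ k.val := by have : k.val < c.val := hck; omega
      simp [factor, hck.ne, hnext, hprev]
  · simp

variable {A}

theorem factor_mul_factor_conj (hp : p < 2) (hA : ∀ k, ‖A k‖ ≤ 1) (hlast : ‖A (Fin.last m)‖ = 1) :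
    factor p A * factor p (fun k => conj (A k)) = 1 := by
  refine Matrix.ext_iff_mulVec.2 fun x => ?_
  rw [← mulVec_mulVec, one_mulVec]
  refine eq_of_blocks hp (fun k hk => ?_) (fun k hk => ?_) (fun hm => ?_) fun hp => ?_
  · rw [factor_mulVec_castSucc A _ hk, factor_mulVec_castSucc _ _ hk, factor_mulVec_succ _ _ hk,
      rho_conj, Complex.conj_conj]
    linear_combination x k.castSucc * rho_sq (hA k.castSucc)
  · rw [factor_mulVec_succ A _ hk, factor_mulVec_castSucc _ _ hk, factor_mulVec_succ _ _ hk,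
      rho_conj, Complex.conj_conj]
    linear_combination x k.succ * rho_sq (hA k.castSucc)
  · rw [factor_mulVec_last A _ hm, factor_mulVec_last _ _ hm, ← mul_assoc, Complex.mul_conj',
      Complex.norm_conj, hlast, Complex.ofReal_one, one_pow, one_mul]
  · rw [factor_mulVec_zero A _ hp, factor_mulVec_zero _ _ hp]

end Factor

theorem factor_transpose {n : ℕ} (p : ℕ) (A : Fin n → ℂ) : (factor p A)ᵀ = factor p A := by
  ext i j
  simp only [transpose_apply, factor, of_apply]
  by_cases h : i = j
  · subst h; simp
  · rw [if_neg h, if_neg (Ne.symm h)]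
    split_ifs <;> first | rfl | omega

theorem factor_conjTranspose {n : ℕ} (p : ℕ) (A : Fin n → ℂ) :
    (factor p A)ᴴ = factor p (fun k => conj (A k)) := by
  rw [← factor_transpose p A, conjTranspose, transpose_transpose]
  ext i j
  simp only [map_apply, factor, of_apply, rho_conj]
  split_ifs <;> simp

section CmvAt

variable {m : ℕ} {a : ℂ} {α : Fin m → ℂ}

/-- All the Verblunsky coefficients `α₀, …, α_{m-1}, a` of `cmvAt a α`. -/
abbrev verblunsky (a : ℂ) (α : Fin m → ℂ) : Fin (m + 1) → ℂ := Fin.snoc (α := fun _ => ℂ) α a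

theorem factor_verblunsky_mul_conj {p : ℕ} (hp : p < 2) (ha : ‖a‖ = 1) (hα : ∀ k, ‖α k‖ < 1) :
    factor p (verblunsky a α) * factor p (fun k => conj (verblunsky a α k)) = 1 := by
  refine factor_mul_factor_conj hp (fun k => ?_) (by simpa using ha)
  induction k using Fin.lastCases with
  | last => simpa using ha.le
  | cast k => simpa using (hα k).le

theorem cmvAt_mul_conjTranspose (ha : ‖a‖ = 1) (hα : ∀ k, ‖α k‖ < 1) :
    cmvAt a α * (cmvAt a α)ᴴ = 1 := by
  rw [cmvAt, cmv, conjTranspose_mul, factor_conjTranspose, factor_conjTranspose, Matrix.mul_assoc,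
    ← Matrix.mul_assoc (factor 1 _) (factor 1 _), factor_verblunsky_mul_conj one_lt_two ha hα,
    Matrix.one_mul, factor_verblunsky_mul_conj two_pos ha hα]

theorem eq_zero_of_factor_zero_mulVec_eq {ζ : ℂ} (hζ : ζ ≠ 0) (hα : ∀ k, ‖α k‖ < 1)
    {x : Fin (m + 1) → ℂ} (hx : x 0 = 0)
    (h : factor 0 (verblunsky a α) *ᵥ x
      = ζ • factor 1 (fun k => conj (verblunsky a α k)) *ᵥ x) : x = 0 := by
  have hle : ∀ k, ∀ j ≤ k, x j = 0 := fun k => by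
    induction k using Fin.induction with
    | zero => exact fun j hj => (Fin.le_zero_iff.1 hj) ▸ hx
    | succ k ih =>
      have hrow := congrFun h k.castSucc
      rw [Pi.smul_apply, factor_mulVec_castSucc_of_eq_zero _ x ih,
        factor_mulVec_castSucc_of_eq_zero _ x ih] at hrow
      have hk : x k.succ = 0 := by
        have hρ := (rho_pos (hα k)).ne'
        rcases Nat.mod_two_eq_zero_or_one k with hpar | hpar <;>
          simpa [hpar, hρ, hζ, rho_conj] using hrow
      intro j hj
      rcases hj.lt_or_eq with hj | rfl
      · exact ih j (Fin.le_castSucc_iff.2 hj)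
      · exact hk
  exact funext fun k => hle k k le_rfl

/-- The vector `e₁` is cyclic. -/
theorem eigenvector_cmvAt_zero_ne_zero (ha : ‖a‖ = 1) {ζ : ℂ} (hζ : ζ ≠ 0) (hα : ∀ k, ‖α k‖ < 1)
    {y : Fin (m + 1) → ℂ} (hy : y ≠ 0) (h : cmvAt a α *ᵥ y = ζ • y) : y 0 ≠ 0 := by
  intro hy0
  have hinv : factor 1 (fun k => conj (verblunsky a α k)) *ᵥ (factor 1 (verblunsky a α) *ᵥ y)
      = y := by
    rw [mulVec_mulVec, mul_eq_one_comm.1 (factor_verblunsky_mul_conj one_lt_two ha hα),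
      one_mulVec]
  have hzero : factor 1 (verblunsky a α) *ᵥ y = 0 :=
    eq_zero_of_factor_zero_mulVec_eq hζ hα
      ((factor_mulVec_zero _ _ one_ne_zero).trans hy0) (by rw [hinv, mulVec_mulVec]; exact h)
  exact hy (by rw [← hinv, hzero, mulVec_zero])

end CmvAt

/-! ### The resolvent of a CMV matrix -/

section Resolvent

theorem conj_mul_schurStep_add {γ z g : ℂ} (hγ : ‖γ‖ ≤ 1) (hd : 1 + conj γ * z * g ≠ 0) :
    conj γ * schurStep γ z g + (rho γ : ℂ) ^ 2 / (1 + conj γ * z * g) = 1 := by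
  rw [schurStep, rho_sq hγ]
  field_simp
  ring

theorem add_mul_div_eq_schurStep {γ z g : ℂ} (hγ : ‖γ‖ ≤ 1) (hd : 1 + conj γ * z * g ≠ 0) :
    γ + (rho γ : ℂ) ^ 2 * (z * g) / (1 + conj γ * z * g) = schurStep γ z g := by
  rw [schurStep, rho_sq hγ]
  field_simp
  ring

variable {m : ℕ} {a z : ℂ} {α : Fin m → ℂ}

/-- The scale of the entries of the solution of `(𝓛 - z 𝓜*) x = c e₁`; the ratio of consecutive
scales is read off from the `2 × 2` blocks. -/
def schurScale (a z : ℂ) (α : Fin m → ℂ) : Fin (m + 1) → ℂ :=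
  Fin.induction 1 fun k d =>
    rho (α k) / (1 + conj (α k) * z * schur a z α k.succ) * (if k.val % 2 = 0 then 1 else z) * d

theorem schurScale_zero : schurScale a z α 0 = 1 := rfl

theorem schurScale_succ (k : Fin m) : schurScale a z α k.succ =
    rho (α k) / (1 + conj (α k) * z * schur a z α k.succ) * (if k.val % 2 = 0 then 1 else z)
      * schurScale a z α k.castSucc := rfl

/-- The solution of `(𝓛 - z 𝓜*) x = c e₁`. -/
def schurVec (a z : ℂ) (α : Fin m → ℂ) (k : Fin (m + 1)) : ℂ :=
  if k.val % 2 = 0 then schur a z α k * schurScale a z α k else schurScale a z α k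

/-- The image of `schurVec a z α` under `𝓛`, and up to the first entry also under `z 𝓜*`. -/
def schurVecImage (a z : ℂ) (α : Fin m → ℂ) (k : Fin (m + 1)) : ℂ :=
  if k.val % 2 = 0 then schurScale a z α k else z * (schur a z α k * schurScale a z α k)

theorem factor_zero_mulVec_schurVec (ha : ‖a‖ = 1) (hz : ‖z‖ < 1) (hα : ∀ k, ‖α k‖ < 1) :
    factor 0 (verblunsky a α) *ᵥ schurVec a z α = schurVecImage a z α := by
  refine eq_of_blocks two_pos (fun k hk => ?_) (fun k hk => ?_) (fun hm => ?_) (absurd rfl)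
  · have hd := schur_den_ne_zero ha.le hz hα k
    have hk' : ¬ (k.val + 1) % 2 = 0 := by omega
    rw [factor_mulVec_castSucc _ _ hk]
    simp only [Fin.snoc_castSucc, schurVec, schurVecImage, Fin.val_castSucc, Fin.val_succ, hk, hk',
      if_true, if_false, schurScale_succ, schur_castSucc]
    linear_combination schurScale a z α k.castSucc * conj_mul_schurStep_add (hα k).le hd
  · have hk' : ¬ (k.val + 1) % 2 = 0 := by omega
    rw [factor_mulVec_succ _ _ hk]
    simp only [Fin.snoc_castSucc, schurVec, schurVecImage, Fin.val_castSucc, Fin.val_succ, hk, hk',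
      if_true, if_false, schurScale_succ, schur_castSucc, schurStep]
    ring
  · rw [factor_mulVec_last _ _ hm]
    simp only [Fin.snoc_last, schurVec, schurVecImage, Fin.val_last, hm, if_true, schur_last]
    rw [← mul_assoc, Complex.conj_mul', ha, Complex.ofReal_one, one_pow, one_mul]

theorem smul_factor_one_mulVec_schurVec (ha : ‖a‖ = 1) (hz : ‖z‖ < 1) (hα : ∀ k, ‖α k‖ < 1) :
    z • factor 1 (fun k => conj (verblunsky a α k)) *ᵥ schurVec a z α
      = Function.update (schurVecImage a z α) 0 (z * schur a z α 0) := by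
  refine eq_of_blocks one_lt_two (fun k hk => ?_) (fun k hk => ?_) (fun hm => ?_) fun _ => ?_
  · have hd := schur_den_ne_zero ha.le hz hα k
    have hk' : (k.val + 1) % 2 = 0 := by omega
    have hk0 : k.castSucc ≠ 0 := fun h => by
      have : k.val = 0 := congrArg Fin.val h
      omega
    rw [Pi.smul_apply, factor_mulVec_castSucc _ _ hk, Function.update_of_ne hk0, smul_eq_mul]
    simp only [Fin.snoc_castSucc, schurVec, schurVecImage, Fin.val_castSucc, Fin.val_succ, hk, hk',
      if_true, if_false, one_ne_zero, schurScale_succ, schur_castSucc, rho_conj, Complex.conj_conj]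
    linear_combination z * schurScale a z α k.castSucc * add_mul_div_eq_schurStep (hα k).le hd
  · have hd := schur_den_ne_zero ha.le hz hα k
    have hk' : (k.val + 1) % 2 = 0 := by omega
    rw [Pi.smul_apply, factor_mulVec_succ _ _ hk, Function.update_of_ne (Fin.succ_ne_zero k),
      smul_eq_mul]
    simp only [Fin.snoc_castSucc, schurVec, schurVecImage, Fin.val_castSucc, Fin.val_succ, hk, hk',
      if_true, if_false, one_ne_zero, schurScale_succ, rho_conj]
    linear_combination (-z * rho (α k) * schurScale a z α k.castSucc) * inv_mul_cancel₀ hd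
  · have hm0 : Fin.last m ≠ 0 := fun h => by
      have : m = 0 := congrArg Fin.val h
      omega
    rw [Pi.smul_apply, factor_mulVec_last _ _ hm, Function.update_of_ne hm0]
    simp [schurVec, schurVecImage, hm]
  · rw [Pi.smul_apply, factor_mulVec_zero _ _ one_ne_zero]
    simp [schurVec, schurScale_zero]

theorem exists_cmvAt_mulVec_sub (ha : ‖a‖ = 1) (hz : ‖z‖ < 1) (hα : ∀ k, ‖α k‖ < 1) :
    ∃ y : Fin (m + 1) → ℂ, y 0 = schur a z α 0 ∧
      cmvAt a α *ᵥ y - z • y = Pi.single 0 (1 - z * schur a z α 0) := by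
  refine ⟨factor 1 (fun k => conj (verblunsky a α k)) *ᵥ schurVec a z α, ?_, ?_⟩
  · rw [factor_mulVec_zero _ _ one_ne_zero]
    simp [schurVec, schurScale_zero]
  · rw [smul_factor_one_mulVec_schurVec ha hz hα, cmvAt, cmv, mulVec_mulVec, Matrix.mul_assoc,
      factor_verblunsky_mul_conj one_lt_two ha hα, Matrix.mul_one,
      factor_zero_mulVec_schurVec ha hz hα]
    ext k
    rcases eq_or_ne k 0 with rfl | hk
    · simp [schurVecImage, schurScale_zero]
    · simp [hk]

end Resolvent

/-! ### Unitary matrices with simple spectrum -/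

theorem eigenspace_eq_span_singleton {K V ι : Type*} [Field K] [AddCommGroup V] [Module K V]
    {f : Module.End K V} (b : Module.Basis ι K V) {ζ : ι → K} (hζ : Function.Injective ζ)
    (hb : ∀ i, f (b i) = ζ i • b i) (j : ι) : f.eigenspace (ζ j) = K ∙ b j := by
  classical
  have hcoord : ∀ k, (b.coord k).comp f = ζ k • b.coord k := fun k => b.ext fun i => by
    rcases eq_or_ne i k with rfl | hik
    · simp [hb]
    · simp [hb, Finsupp.single_eq_of_ne hik.symm]
  ext w
  rw [Module.End.mem_eigenspace_iff, Submodule.mem_span_singleton]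
  constructor
  · intro hw
    refine ⟨b.coord j w, b.ext_elem fun k => ?_⟩
    rcases eq_or_ne j k with rfl | hjk
    · simp
    · have hk : (ζ j - ζ k) * b.coord k w = 0 := by
        have h := LinearMap.congr_fun (hcoord k) w
        rw [LinearMap.comp_apply, hw, map_smul, LinearMap.smul_apply, smul_eq_mul,
          smul_eq_mul] at h
        rw [sub_mul, h, sub_self]
      have hk' : b.repr w k = 0 := (mul_eq_zero.1 hk).resolve_left (sub_ne_zero.2 (hζ.ne hjk))
      simp [hk', Finsupp.single_eq_of_ne hjk.symm]
  · rintro ⟨c, rfl⟩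
    rw [map_smul, hb, smul_comm]

section Eigenvectors

variable {ι : Type*} [Fintype ι] [DecidableEq ι] {B : Matrix ι ι ℂ}

theorem inner_eq_zero_of_eigenvectors (hB : B * Bᴴ = 1) {z w : ℂ} (hz : ‖z‖ = 1) (hzw : z ≠ w)
    {u v : EuclideanSpace ℂ ι} (hu : toEuclideanLin B u = z • u) (hv : toEuclideanLin B v = w • v) :
    inner ℂ u v = 0 := by
  have hinner : inner ℂ (toEuclideanLin B u) (toEuclideanLin B v) = inner ℂ u v := by
    rw [← LinearMap.adjoint_inner_right, ← Matrix.toEuclideanLin_conjTranspose_eq_adjoint]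
    congr 1
    rw [toLpLin_apply, toLpLin_apply, mulVec_mulVec, mul_eq_one_comm.1 hB, one_mulVec]
  rw [hu, hv, inner_smul_left, inner_smul_right] at hinner
  have hzz : z * conj z = 1 := by rw [Complex.mul_conj', hz, Complex.ofReal_one, one_pow]
  have hne : conj z * w - 1 ≠ 0 := fun h => hzw (by linear_combination w * hzz - z * h)
  have hmul : (conj z * w - 1) * inner ℂ u v = 0 := by linear_combination hinner
  exact (mul_eq_zero.1 hmul).resolve_left hne

theorem exists_orthonormalBasis_eigenvectors (hB : B * Bᴴ = 1) {ζ : ι → ℂ}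
    (hζ : Function.Injective ζ) (hζ₁ : ∀ j, ‖ζ j‖ = 1) (hsp : ∀ j, ζ j ∈ spectrum ℂ B) :
    ∃ b : OrthonormalBasis ι ℂ (EuclideanSpace ℂ ι), ∀ j, toEuclideanLin B (b j) = ζ j • b j := by
  have hex : ∀ j, ∃ v : EuclideanSpace ℂ ι, ‖v‖ = 1 ∧ toEuclideanLin B v = ζ j • v := fun j => by
    have heig : Module.End.HasEigenvalue (toEuclideanLin B) (ζ j) := by
      rw [Module.End.hasEigenvalue_iff_mem_spectrum, spectrum_toLpLin]
      exact hsp j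
    obtain ⟨v, hv⟩ := heig.exists_hasEigenvector
    exact ⟨(‖v‖ : ℂ)⁻¹ • v, norm_smul_inv_norm hv.2, by rw [map_smul, hv.apply_eq_smul, smul_comm]⟩
  choose v hv₁ hv using hex
  have hon : Orthonormal ℂ v := ⟨hv₁, fun j k hjk =>
    inner_eq_zero_of_eigenvectors hB (hζ₁ j) (hζ.ne hjk) (hv j) (hv k)⟩
  have hcard : Module.finrank ℂ (EuclideanSpace ℂ ι) = Fintype.card ι := by simp
  obtain ⟨b, hb⟩ := Orthonormal.exists_orthonormalBasis_extension_of_card_eq (s := Set.univ) hcard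
    (hon.comp _ Subtype.val_injective)
  exact ⟨b, fun j => by rw [hb j (Set.mem_univ j), hv]⟩

end Eigenvectors

theorem spectralMass_eq_norm_sq {m : ℕ} {B : Matrix (Fin (m + 1)) (Fin (m + 1)) ℂ}
    {ζ : Fin (m + 1) → ℂ} (hζ : Function.Injective ζ)
    (b : OrthonormalBasis (Fin (m + 1)) ℂ (EuclideanSpace ℂ (Fin (m + 1))))
    (hb : ∀ j, toEuclideanLin B (b j) = ζ j • b j) (j : Fin (m + 1)) :
    spectralMass B (ζ j) = ‖b j 0‖ ^ 2 := by
  have hspan : Module.End.eigenspace (toEuclideanLin B) (ζ j) = ℂ ∙ b j := by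
    simpa using eigenspace_eq_span_singleton b.toBasis hζ (by simpa using hb) j
  simp only [spectralMass, hspan]
  rw [Submodule.starProjection_unit_singleton ℂ (b.norm_eq_one j), norm_smul, b.norm_eq_one,
    mul_one, EuclideanSpace.inner_single_right]
  simp

theorem exists_unitary_diagonalization {m : ℕ} {B : Matrix (Fin (m + 1)) (Fin (m + 1)) ℂ}
    (hB : B * Bᴴ = 1) {ζ : Fin (m + 1) → ℂ} (hζ : Function.Injective ζ) (hζ₁ : ∀ j, ‖ζ j‖ = 1)
    (hsp : ∀ j, ζ j ∈ spectrum ℂ B) :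
    ∃ W : Matrix (Fin (m + 1)) (Fin (m + 1)) ℂ, W * Wᴴ = 1 ∧ B = W * diagonal ζ * Wᴴ ∧
      ∀ j, spectralMass B (ζ j) = ‖W 0 j‖ ^ 2 := by
  obtain ⟨b, hb⟩ := exists_orthonormalBasis_eigenvectors hB hζ hζ₁ hsp
  let W : Matrix (Fin (m + 1)) (Fin (m + 1)) ℂ := of fun i j => b j i
  have hW : W * Wᴴ = 1 := by
    rw [mul_eq_one_comm]
    ext j k
    rw [one_apply, ← orthonormal_iff_ite.1 b.orthonormal j k, PiLp.inner_apply, mul_apply]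
    exact Finset.sum_congr rfl fun i _ => by simp [W, mul_comm]
  have hBW : B * W = W * diagonal ζ := by
    ext i j
    rw [mul_diagonal, mul_comm (W i j)]
    have h := congrArg (fun u : EuclideanSpace ℂ (Fin (m + 1)) => u i) (hb j)
    simp only [toLpLin_apply, PiLp.smul_apply, smul_eq_mul] at h
    exact h
  exact ⟨W, hW, by rw [← hBW, Matrix.mul_assoc, hW, Matrix.mul_one],
    spectralMass_eq_norm_sq hζ b hb⟩

theorem adjugate_mul_mul_of_mul_eq_one {ι R : Type*} [Fintype ι] [DecidableEq ι] [CommRing R]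
    {W W' : Matrix ι ι R} (h : W * W' = 1) (D : Matrix ι ι R) :
    (W * D * W').adjugate = W * D.adjugate * W' := by
  have hadj : ∀ {X Y : Matrix ι ι R}, X * Y = 1 → X.adjugate = X.det • Y := fun {X Y} hXY => by
    rw [← Matrix.mul_one X.adjugate, ← hXY, ← Matrix.mul_assoc, adjugate_mul, Matrix.smul_mul,
      Matrix.one_mul]
  have hdet : W'.det * W.det = 1 := by rw [← det_mul, mul_eq_one_comm.1 h, det_one]
  rw [adjugate_mul_distrib, adjugate_mul_distrib, hadj h, hadj (mul_eq_one_comm.1 h),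
    Matrix.smul_mul, Matrix.mul_smul, Matrix.mul_smul, smul_smul, hdet, one_smul, Matrix.mul_assoc]

section Diagonalized

variable {ι : Type*} [Fintype ι] [DecidableEq ι] {B W : Matrix ι ι ℂ} {ζ : ι → ℂ}

/-- `⟨e_i, (B - z)⁻¹ e_i⟩` is the Cauchy transform of the spectral measure of `B` and `e_i`. -/
theorem apply_eq_mul_cauchy (hW : W * Wᴴ = 1) (hB : B = W * diagonal ζ * Wᴴ) {z c : ℂ}
    (hz : ∀ j, ζ j - z ≠ 0) {i : ι} {y : ι → ℂ} (hy : B *ᵥ y - z • y = Pi.single i c) :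
    y i = c * cauchy (fun j => ((‖W i j‖ ^ 2 : ℝ) : ℂ)) ζ z := by
  set u := Wᴴ *ᵥ y with hu
  have hyu : y = W *ᵥ u := by rw [hu, mulVec_mulVec, hW, one_mulVec]
  have hWB : Wᴴ *ᵥ (B *ᵥ y) = diagonal ζ *ᵥ u := by
    rw [hB, mulVec_mulVec, ← Matrix.mul_assoc, ← Matrix.mul_assoc, mul_eq_one_comm.1 hW,
      Matrix.one_mul, ← mulVec_mulVec]
  have hcoord : ∀ j, u j = c * conj (W i j) / (ζ j - z) := fun j => by
    have h : ζ j * u j - z * u j = conj (W i j) * c := by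
      simpa [mulVec_sub, mulVec_smul, hWB, ← hu, mulVec_diagonal] using
        congrFun (congrArg (fun x => Wᴴ *ᵥ x) hy) j
    rw [eq_div_iff (hz j)]
    linear_combination h
  rw [hyu, mulVec, dotProduct, cauchy, Finset.mul_sum]
  refine Finset.sum_congr rfl fun j _ => ?_
  rw [hcoord, Complex.ofReal_pow, ← Complex.mul_conj']
  ring

theorem smul_one_sub_eq_mul_diagonal_mul (hW : W * Wᴴ = 1) (hB : B = W * diagonal ζ * Wᴴ) (z : ℂ) :
    z • (1 : Matrix ι ι ℂ) - B = W * diagonal (fun j => z - ζ j) * Wᴴ := by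
  have hdiag : diagonal (fun j => z - ζ j) = z • (1 : Matrix ι ι ℂ) - diagonal ζ := by
    rw [smul_one_eq_diagonal, diagonal_sub]
  rw [hdiag, Matrix.mul_sub, Matrix.sub_mul, hB, Matrix.mul_smul, Matrix.mul_one, Matrix.smul_mul,
    hW]

theorem det_smul_one_sub (hW : W * Wᴴ = 1) (hB : B = W * diagonal ζ * Wᴴ) (z : ℂ) :
    (z • (1 : Matrix ι ι ℂ) - B).det = ∏ j, (z - ζ j) := by
  rw [smul_one_sub_eq_mul_diagonal_mul hW hB, det_mul_right_comm, hW, Matrix.one_mul, det_diagonal]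

theorem adjugate_smul_one_sub (hW : W * Wᴴ = 1) (hB : B = W * diagonal ζ * Wᴴ) (j : ι) :
    (ζ j • (1 : Matrix ι ι ℂ) - B).adjugate
      = W * single j j (∏ k ∈ Finset.univ.erase j, (ζ j - ζ k)) * Wᴴ := by
  rw [smul_one_sub_eq_mul_diagonal_mul hW hB, adjugate_mul_mul_of_mul_eq_one hW, adjugate_diagonal,
    ← diagonal_single]
  congr 3
  ext i
  rcases eq_or_ne i j with rfl | hij
  · rw [Pi.single_eq_same]
  · rw [Pi.single_eq_of_ne hij]
    exact Finset.prod_eq_zero (Finset.mem_erase.2 ⟨hij.symm, Finset.mem_univ j⟩) (sub_self _)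

theorem norm_sq_eq_adjugate_div_trace (hζ : Function.Injective ζ) (hW : W * Wᴴ = 1)
    (hB : B = W * diagonal ζ * Wᴴ) (i j : ι) :
    (ζ j • (1 : Matrix ι ι ℂ) - B).adjugate.trace ≠ 0 ∧
    ((‖W i j‖ ^ 2 : ℝ) : ℂ) = (ζ j • (1 : Matrix ι ι ℂ) - B).adjugate i i
      / (ζ j • (1 : Matrix ι ι ℂ) - B).adjugate.trace := by
  have hprod : ∏ k ∈ Finset.univ.erase j, (ζ j - ζ k) ≠ 0 :=
    Finset.prod_ne_zero_iff.2 fun k hk => sub_ne_zero.2 (hζ.ne (Finset.ne_of_mem_erase hk).symm)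
  rw [adjugate_smul_one_sub hW hB]
  generalize ∏ k ∈ Finset.univ.erase j, (ζ j - ζ k) = p at hprod
  have htrace : (W * single j j p * Wᴴ).trace = p := by
    rw [trace_mul_cycle, mul_eq_one_comm.1 hW, Matrix.one_mul, trace_single_eq_same]
  have hentry : (W * single j j p * Wᴴ) i i = p * (W i j * conj (W i j)) := by
    rw [← diagonal_single, mul_apply]
    simp only [mul_diagonal, conjTranspose_apply]
    rw [Finset.sum_eq_single j (fun k _ hk => by simp [hk]) (by simp), Pi.single_eq_same]
    simp
    ring
  rw [htrace, hentry, mul_div_cancel_left₀ _ hprod, Complex.ofReal_pow, Complex.mul_conj']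
  exact ⟨hprod, rfl⟩

end Diagonalized

/-! ### Hamiltonian vector fields of the Gelfand–Dikij bracket -/

section HamVec

variable {n : ℕ}

/-- The value at `B` of the Gelfand–Dikij Hamiltonian vector field of a function with gradient
`X`. -/
def hamVec (X B : Matrix (Fin n) (Fin n) ℂ) : Matrix (Fin n) (Fin n) ℂ :=
  piA (B * X) * B - B * piA (X * B)

theorem pairing_comm (X Y : Matrix (Fin n) (Fin n) ℂ) : pairing X Y = pairing Y X := by
  rw [pairing, pairing, trace_mul_comm]

theorem pairing_sub_left (X Y Z : Matrix (Fin n) (Fin n) ℂ) :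
    pairing (X - Y) Z = pairing X Z - pairing Y Z := by
  simp [pairing, Matrix.sub_mul, trace_sub]

theorem pairing_mul_left (X Y Z : Matrix (Fin n) (Fin n) ℂ) :
    pairing (X * Y) Z = pairing X (Y * Z) := by
  rw [pairing, pairing, Matrix.mul_assoc]

theorem pairing_mul_rotate (X Y Z : Matrix (Fin n) (Fin n) ℂ) :
    pairing (X * Y) Z = pairing Y (Z * X) := by
  rw [pairing_comm, ← pairing_mul_left, pairing_comm]

theorem gdBracket_eq_pairing_hamVec (φ ψ : Matrix (Fin n) (Fin n) ℂ → ℝ)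
    (B : Matrix (Fin n) (Fin n) ℂ) :
    gdBracket φ ψ B = pairing (hamVec (grad φ B) B) (grad ψ B) := by
  have hR : ∀ Z : Matrix (Fin n) (Fin n) ℂ, R Z = Z - piA Z - piA Z := fun Z => rfl
  have hswap : pairing (grad φ B * B) (grad ψ B * B) = pairing (B * grad φ B) (B * grad ψ B) := by
    rw [pairing_mul_left, pairing_mul_rotate, Matrix.mul_assoc]
  rw [gdBracket, hamVec, pairing_sub_left, pairing_mul_left (piA _) B, pairing_mul_rotate B, hR, hR]
  simp only [pairing_sub_left]
  linarith

theorem pairing_grad (φ : Matrix (Fin n) (Fin n) ℂ → ℝ) (B D : Matrix (Fin n) (Fin n) ℂ) :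
    pairing D (grad φ B) = fderiv ℝ φ B D := by
  have hD : D = ∑ k, ∑ l, ((D k l).re • Matrix.single k l (1 : ℂ)
      + (D k l).im • Matrix.single k l Complex.I) := by
    conv_lhs => rw [matrix_eq_sum_single D]
    refine Finset.sum_congr rfl fun k _ => Finset.sum_congr rfl fun l _ => ?_
    rw [Matrix.smul_single, Matrix.smul_single, ← Matrix.single_add]
    congr 1
    apply Complex.ext <;> simp
  conv_rhs => rw [hD]
  simp only [map_sum, map_add, map_smul, smul_eq_mul]
  rw [pairing, trace, Complex.im_sum]
  refine Finset.sum_congr rfl fun k _ => ?_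
  rw [diag_apply, Matrix.mul_apply, Complex.im_sum]
  refine Finset.sum_congr rfl fun l _ => ?_
  simp [grad]

/-- The Gelfand–Dikij Poisson structure is multiplicative. -/
theorem hamVec_mul (X A B : Matrix (Fin n) (Fin n) ℂ) :
    hamVec X (A * B) = hamVec (B * X) A * B + A * hamVec (X * A) B := by
  simp only [hamVec, Matrix.mul_sub, Matrix.sub_mul, Matrix.mul_assoc]
  abel

theorem piA_apply_of_lt (X : Matrix (Fin n) (Fin n) ℂ) {i j : Fin n} (h : i < j) :
    piA X i j = X i j := by simp [piA, h]

theorem piA_apply_of_gt (X : Matrix (Fin n) (Fin n) ℂ) {i j : Fin n} (h : j < i) :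
    piA X i j = -Xᴴ i j := by simp [piA, h.not_gt, h.ne']

theorem piA_submatrix {l : ℕ} (X : Matrix (Fin n) (Fin n) ℂ) {f : Fin l → Fin n}
    (hf : StrictMono f) : piA (X.submatrix f f) = (piA X).submatrix f f := by
  ext i j
  simp [piA, hf.lt_iff_lt, hf.injective.eq_iff]

end HamVec

/-! ### Block-diagonal matrices -/

section BlockDiagonal

variable {n : ℕ} {b : Fin n → ℕ} {X F : Matrix (Fin n) (Fin n) ℂ}

theorem hamVec_apply_of_block_lt (hb : Monotone b) (hF : ∀ i j, b i ≠ b j → F i j = 0)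
    {i j : Fin n} (hij : b i < b j) : hamVec X F i j = 0 := by
  have hleft : (piA (F * X) * F) i j = (F * X * F) i j := by
    rw [Matrix.mul_apply, Matrix.mul_apply]
    refine Finset.sum_congr rfl fun l _ => ?_
    by_cases hl : b l = b j
    · rw [piA_apply_of_lt _ (hb.reflect_lt (hl ▸ hij))]
    · rw [hF l j hl, mul_zero, mul_zero]
  have hright : (F * piA (X * F)) i j = (F * (X * F)) i j := by
    rw [Matrix.mul_apply, Matrix.mul_apply]
    refine Finset.sum_congr rfl fun l _ => ?_
    by_cases hl : b i = b l
    · rw [piA_apply_of_lt _ (hb.reflect_lt (hl ▸ hij))]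
    · rw [hF i l hl, zero_mul, zero_mul]
  rw [hamVec, Matrix.sub_apply, hleft, hright, Matrix.mul_assoc, sub_self]

theorem hamVec_apply_of_block_gt (hb : Monotone b) (hF : ∀ i j, b i ≠ b j → F i j = 0)
    (hunit : F * Fᴴ = 1) {i j : Fin n} (hij : b j < b i) : hamVec X F i j = 0 := by
  have hleft : (piA (F * X) * F) i j = (-(F * X)ᴴ * F) i j := by
    rw [Matrix.mul_apply, Matrix.mul_apply]
    refine Finset.sum_congr rfl fun l _ => ?_
    by_cases hl : b l = b j
    · rw [piA_apply_of_gt _ (hb.reflect_lt (hl ▸ hij)), Matrix.neg_apply]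
    · rw [hF l j hl, mul_zero, mul_zero]
  have hright : (F * piA (X * F)) i j = (F * -(X * F)ᴴ) i j := by
    rw [Matrix.mul_apply, Matrix.mul_apply]
    refine Finset.sum_congr rfl fun l _ => ?_
    by_cases hl : b i = b l
    · rw [piA_apply_of_gt _ (hb.reflect_lt (hl ▸ hij)), Matrix.neg_apply]
    · rw [hF i l hl, zero_mul, zero_mul]
  rw [hamVec, Matrix.sub_apply, hleft, hright, conjTranspose_mul, conjTranspose_mul, Matrix.neg_mul,
    Matrix.mul_neg, Matrix.mul_assoc, mul_eq_one_comm.1 hunit, ← Matrix.mul_assoc, hunit,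
    Matrix.one_mul, Matrix.mul_one, sub_self]

theorem hamVec_submatrix (hF : ∀ i j, b i ≠ b j → F i j = 0) {l c : ℕ} {f : Fin l → Fin n}
    (hf : StrictMono f) (hfb : ∀ i, i ∈ Set.range f ↔ b i = c) :
    (hamVec X F).submatrix f f = hamVec (X.submatrix f f) (F.submatrix f f) := by
  have hbf : ∀ i, b (f i) = c := fun i => (hfb _).1 ⟨i, rfl⟩
  have hleft : ∀ Y : Matrix (Fin n) (Fin n) ℂ,
      (F * Y).submatrix f f = F.submatrix f f * Y.submatrix f f := fun Y => by
    ext i j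
    refine (Fintype.sum_of_injective f hf.injective _ _ (fun k hk => ?_) fun _ => rfl).symm
    exact mul_eq_zero_of_left (hF _ _ fun h => hk ((hfb k).2 (h ▸ hbf i))) _
  have hright : ∀ Y : Matrix (Fin n) (Fin n) ℂ,
      (Y * F).submatrix f f = Y.submatrix f f * F.submatrix f f := fun Y => by
    ext i j
    refine (Fintype.sum_of_injective f hf.injective _ _ (fun k hk => ?_) fun _ => rfl).symm
    exact mul_eq_zero_of_right _ (hF _ _ fun h => hk ((hfb k).2 (h ▸ hbf j)))
  rw [hamVec, hamVec, ← hleft, ← hright, piA_submatrix _ hf, piA_submatrix _ hf, ← hleft, ← hright]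
  rfl

theorem hamVec_apply_of_singleton_block (hF : ∀ i j, b i ≠ b j → F i j = 0) {i : Fin n}
    (hi : ∀ j, b j = b i → j = i) : hamVec X F i i = 0 := by
  have h := hamVec_submatrix (X := X) hF (f := fun _ : Fin 1 => i) (Subsingleton.strictMono _)
    (c := b i) fun j => ⟨fun ⟨_, hj⟩ => hj ▸ rfl, fun hj => ⟨0, (hi j hj).symm⟩⟩
  have h00 := congrFun (congrFun h 0) 0
  rw [submatrix_apply] at h00
  rw [h00]
  simp [hamVec, Matrix.mul_apply, piA, mul_comm]

end BlockDiagonal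

section EmbedBlock

variable {m : ℕ}

/-- The indices of the `k`-th `2 × 2` block. -/
def blockIdx (k : Fin m) : Fin 2 → Fin (m + 1) := ![k.castSucc, k.succ]

theorem blockIdx_strictMono (k : Fin m) : StrictMono (blockIdx k) :=
  Fin.strictMono_iff_lt_succ.2 fun i => by
    rw [Subsingleton.elim i 0]
    exact k.castSucc_lt_succ

theorem mem_range_blockIdx {p : ℕ} {k : Fin m} (hk : k.val % 2 = p) (i : Fin (m + 1)) :
    i ∈ Set.range (blockIdx k) ↔ (i.val + p) / 2 = (k.val + p) / 2 := by
  simp [blockIdx, Fin.ext_iff]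
  omega

/-- The matrix with the given `2 × 2` block at the indices `k, k + 1`, and zero elsewhere. -/
def embedBlock (k : Fin m) :
    Matrix (Fin 2) (Fin 2) ℂ →ₗ[ℝ] Matrix (Fin (m + 1)) (Fin (m + 1)) ℂ where
  toFun M := (1 : Matrix _ _ ℂ).submatrix id (blockIdx k) * M
    * (1 : Matrix _ _ ℂ).submatrix (blockIdx k) id
  map_add' M N := by rw [Matrix.mul_add, Matrix.add_mul]
  map_smul' c M := by rw [Matrix.mul_smul, Matrix.smul_mul, RingHom.id_apply]

theorem embedBlock_submatrix_apply {p : ℕ} {k : Fin m} (hk : k.val % 2 = p)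
    {H : Matrix (Fin (m + 1)) (Fin (m + 1)) ℂ}
    (hH : ∀ i j : Fin (m + 1), (i.val + p) / 2 ≠ (j.val + p) / 2 → H i j = 0)
    (i j : Fin (m + 1)) :
    embedBlock k (H.submatrix (blockIdx k) (blockIdx k)) i j
      = if (i.val + p) / 2 = (k.val + p) / 2 then H i j else 0 := by
  have hsum : embedBlock k (H.submatrix (blockIdx k) (blockIdx k)) i j
      = if i ∈ Set.range (blockIdx k) ∧ j ∈ Set.range (blockIdx k) then H i j else 0 := by
    have hne := k.castSucc_lt_succ.ne
    simp only [embedBlock, LinearMap.coe_mk, AddHom.coe_mk, Matrix.mul_apply, Fin.sum_univ_two,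
      submatrix_apply, one_apply, blockIdx, cons_val_zero, cons_val_one, id, Set.mem_range,
      Fin.exists_fin_two]
    grind
  simp only [hsum, mem_range_blockIdx hk]
  have := hH i j
  grind

theorem pairing_embedBlock (X : Matrix (Fin (m + 1)) (Fin (m + 1)) ℂ) (k : Fin m)
    (M : Matrix (Fin 2) (Fin 2) ℂ) :
    pairing X (embedBlock k M) = pairing (X.submatrix (blockIdx k) (blockIdx k)) M := by
  have hX : X.submatrix (blockIdx k) (blockIdx k)
      = (1 : Matrix (Fin (m + 1)) (Fin (m + 1)) ℂ).submatrix (blockIdx k) id * X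
        * (1 : Matrix (Fin (m + 1)) (Fin (m + 1)) ℂ).submatrix id (blockIdx k) := by
    ext i j
    simp [Matrix.mul_apply, one_apply]
  rw [pairing, pairing, hX]
  simp only [embedBlock, LinearMap.coe_mk, AddHom.coe_mk]
  rw [← Matrix.mul_assoc, trace_mul_comm]
  simp only [Matrix.mul_assoc]

theorem exists_block_iff {p : ℕ} (hp : p < 2) (i : Fin (m + 1)) :
    (∃ k : Fin m, k.val % 2 = p ∧ (i.val + p) / 2 = (k.val + p) / 2)
      ↔ ¬(m % 2 = p ∧ i = Fin.last m) ∧ ¬(p ≠ 0 ∧ i = 0) := by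
  simp only [Fin.ext_iff, Fin.val_last, Fin.val_zero]
  constructor
  · rintro ⟨k, hk, hik⟩
    omega
  · rintro ⟨hlast, hzero⟩
    by_cases hip : i.val % 2 = p
    · exact ⟨⟨i, by omega⟩, hip, rfl⟩
    · exact ⟨⟨i - 1, by omega⟩, by dsimp only; omega, by dsimp only; omega⟩

theorem eq_sum_embedBlock {p : ℕ} (hp : p < 2) {H : Matrix (Fin (m + 1)) (Fin (m + 1)) ℂ}
    (hH : ∀ i j : Fin (m + 1), (i.val + p) / 2 ≠ (j.val + p) / 2 → H i j = 0) :
    H = (∑ k : Fin m, if k.val % 2 = p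
        then embedBlock k (H.submatrix (blockIdx k) (blockIdx k)) else 0)
      + (if m % 2 = p then Matrix.single (Fin.last m) (Fin.last m) (H (Fin.last m) (Fin.last m))
        else 0)
      + if p ≠ 0 then Matrix.single 0 0 (H 0 0) else 0 := by
  ext i j
  have hblock : ∀ k : Fin m, (if k.val % 2 = p
      then embedBlock k (H.submatrix (blockIdx k) (blockIdx k)) else 0) i j
      = if k.val % 2 = p ∧ (i.val + p) / 2 = (k.val + p) / 2 then H i j else 0 := fun k => by
    by_cases hk : k.val % 2 = p
    · simp [hk, embedBlock_submatrix_apply hk hH]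
    · simp [hk]
  simp only [Matrix.add_apply, Matrix.sum_apply, hblock]
  by_cases hi : ∃ k : Fin m, k.val % 2 = p ∧ (i.val + p) / 2 = (k.val + p) / 2
  · obtain ⟨hlast, hzero⟩ := (exists_block_iff hp i).1 hi
    obtain ⟨k, hk, hik⟩ := hi
    rw [Finset.sum_eq_single k (fun l _ hl => if_neg fun h => hl (Fin.ext (by omega)))
      (fun h => absurd (Finset.mem_univ k) h), if_pos ⟨hk, hik⟩]
    split_ifs <;> simp [Matrix.single_apply] <;> grind
  · have hcorner : m % 2 = p ∧ i = Fin.last m ∨ p ≠ 0 ∧ i = 0 := by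
      rwa [exists_block_iff hp, ← not_or, not_not] at hi
    have hij : j ≠ i → H i j = 0 := fun hne => hH i j fun h => hne <| Fin.ext <| by
      simp only [Fin.ext_iff, Fin.val_last, Fin.val_zero] at hcorner
      omega
    have hdisj : ¬(m % 2 = p ∧ i = Fin.last m ∧ p ≠ 0 ∧ i = 0) := by
      simp only [Fin.ext_iff, Fin.val_last, Fin.val_zero]
      omega
    rw [Finset.sum_eq_zero fun k _ => if_neg fun h => hi ⟨k, h⟩, zero_add]
    split_ifs <;> simp [Matrix.single_apply] <;> grind

end EmbedBlock

section HamVecCMV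

/-- The block `Ξ` with Verblunsky coefficient `γ`. -/
def xi (γ : ℂ) : Matrix (Fin 2) (Fin 2) ℂ := !![conj γ, rho γ; rho γ, -γ]

/-- The derivative of `rho` at `z` in the direction `w`. -/
def drho (z w : ℂ) : ℝ := -(z.re * w.re + z.im * w.im) / rho z

/-- The derivative of `xi` at `γ` in the direction `w`. -/
def dxi (γ w : ℂ) : Matrix (Fin 2) (Fin 2) ℂ := !![conj w, drho γ w; drho γ w, -w]

theorem dxi_zero (γ : ℂ) : dxi γ 0 = 0 := by
  ext i j
  fin_cases i <;> fin_cases j <;> simp [dxi, drho]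

theorem piA_fin_two (x y z w : ℂ) :
    piA !![x, y; z, w] = !![(x.im : ℂ) * Complex.I, y; -conj y, (w.im : ℂ) * Complex.I] := by
  ext i j
  fin_cases i <;> fin_cases j <;> simp [piA]

theorem hamVec_xi {γ : ℂ} (hγ : rho γ ≠ 0) (X : Matrix (Fin 2) (Fin 2) ℂ) :
    hamVec X (xi γ)
      = rho γ ^ 2 • (pairing X (dxi γ 1) • dxi γ Complex.I
        - pairing X (dxi γ Complex.I) • dxi γ 1) := by
  have hre : ((rho γ : ℂ) ^ 2).re = rho γ ^ 2 := by norm_cast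
  have him : ((rho γ : ℂ) ^ 2).im = 0 := by norm_cast
  rw [eta_fin_two X]
  ext i j
  fin_cases i <;> fin_cases j <;> apply Complex.ext <;>
    simp [hamVec, piA_fin_two, xi, dxi, drho, pairing, hre, him] <;>
    field_simp <;> ring

variable {m : ℕ} {p : ℕ} {a : ℂ} {α : Fin m → ℂ}

theorem factor_apply_of_block_ne {n : ℕ} {A : Fin n → ℂ} {i j : Fin n}
    (hij : (i.val + p) / 2 ≠ (j.val + p) / 2) : factor p A i j = 0 := by
  have hne : i ≠ j := fun h => hij (by rw [h])
  simp only [factor, of_apply, if_neg hne]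
  rw [if_neg (by omega), if_neg (by omega)]

theorem factor_submatrix_blockIdx {k : Fin m} (hk : k.val % 2 = p) :
    (factor p (verblunsky a α)).submatrix (blockIdx k) (blockIdx k) = xi (α k) := by
  have hA : verblunsky a α k.castSucc = α k := Fin.snoc_castSucc ..
  have hk' : ¬(k.val + 1) % 2 = p := by omega
  have hne := k.castSucc_lt_succ.ne
  ext i j
  fin_cases i <;> fin_cases j
  · simp [factor, blockIdx, xi, hk, hA]
  · simp [factor, blockIdx, xi, hk, hA, hne]
  · simp [factor, blockIdx, xi, hk, hk', hA, hne.symm]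
  · have hk₀ : verblunsky a α ⟨k.val, by omega⟩ = α k := hA
    simp [factor, blockIdx, xi, hk', hk₀]

/-- The derivative of `factor p (verblunsky a α)` with respect to `α` in the direction `w`. -/
def dfactor (p : ℕ) (α w : Fin m → ℂ) : Matrix (Fin (m + 1)) (Fin (m + 1)) ℂ :=
  ∑ k : Fin m, if k.val % 2 = p then embedBlock k (dxi (α k) (w k)) else 0

theorem dfactor_single (p : ℕ) (α : Fin m → ℂ) (k : Fin m) (v : ℂ) :
    dfactor p α (Pi.single k v) = if k.val % 2 = p then embedBlock k (dxi (α k) v) else 0 := by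
  rw [dfactor, Finset.sum_eq_single k (fun l _ hl => by simp [hl, dxi_zero]) (by simp),
    Pi.single_eq_same]

/-- The Hamiltonian vector field of the Ablowitz–Ladik bracket, for a function of `α` whose partial
derivative at `k` in the direction `v` is `pairing X (D k v)`, pushed forward by `D`. -/
def alVec (α : Fin m → ℂ) (D : Fin m → ℂ → Matrix (Fin (m + 1)) (Fin (m + 1)) ℂ)
    (X : Matrix (Fin (m + 1)) (Fin (m + 1)) ℂ) : Matrix (Fin (m + 1)) (Fin (m + 1)) ℂ :=
  ∑ k, rho (α k) ^ 2 • (pairing X (D k 1) • D k Complex.I - pairing X (D k Complex.I) • D k 1)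

theorem hamVec_factor (hp : p < 2) (ha : ‖a‖ = 1) (hα : ∀ k, ‖α k‖ < 1)
    (X : Matrix (Fin (m + 1)) (Fin (m + 1)) ℂ) :
    hamVec X (factor p (verblunsky a α)) = alVec α (fun k v => dfactor p α (Pi.single k v)) X := by
  have hb : Monotone fun i : Fin (m + 1) => (i.val + p) / 2 := fun i j h =>
    Nat.div_le_div_right (Nat.add_le_add_right h p)
  have hF : ∀ i j : Fin (m + 1), (i.val + p) / 2 ≠ (j.val + p) / 2 →
      factor p (verblunsky a α) i j = 0 := fun _ _ => factor_apply_of_block_ne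
  have hunit : factor p (verblunsky a α) * (factor p (verblunsky a α))ᴴ = 1 := by
    rw [factor_conjTranspose, factor_verblunsky_mul_conj hp ha hα]
  have hH : ∀ i j : Fin (m + 1), (i.val + p) / 2 ≠ (j.val + p) / 2 →
      hamVec X (factor p (verblunsky a α)) i j = 0 := fun i j hij =>
    hij.lt_or_gt.elim (hamVec_apply_of_block_lt hb hF) (hamVec_apply_of_block_gt hb hF hunit)
  have hlast : (if m % 2 = p then Matrix.single (Fin.last m) (Fin.last m)
      (hamVec X (factor p (verblunsky a α)) (Fin.last m) (Fin.last m)) else 0) = 0 := by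
    split_ifs with hm
    · rw [hamVec_apply_of_singleton_block hF fun j hj => Fin.ext ?_, Matrix.single_zero]
      rw [Fin.val_last] at hj ⊢
      omega
    · rfl
  have hzero : (if p ≠ 0 then Matrix.single (0 : Fin (m + 1)) (0 : Fin (m + 1))
      (hamVec X (factor p (verblunsky a α)) 0 0) else 0) = 0 := by
    split_ifs with hp0
    · rw [hamVec_apply_of_singleton_block hF fun j hj => Fin.ext ?_, Matrix.single_zero]
      rw [Fin.val_zero] at hj ⊢
      omega
    · rfl
  rw [eq_sum_embedBlock hp hH, hlast, hzero, add_zero, add_zero, alVec]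
  refine Finset.sum_congr rfl fun k _ => ?_
  by_cases hk : k.val % 2 = p
  · simp only [dfactor_single, if_pos hk]
    rw [hamVec_submatrix hF (blockIdx_strictMono k) (mem_range_blockIdx hk),
      factor_submatrix_blockIdx hk, hamVec_xi (rho_pos (hα k)).ne']
    simp only [pairing_embedBlock, map_smul, map_sub]
  · simp [dfactor_single, hk]

end HamVecCMV

section AlVec

variable {m : ℕ} {α : Fin m → ℂ} (D D' : Fin m → ℂ → Matrix (Fin (m + 1)) (Fin (m + 1)) ℂ)
  (X F : Matrix (Fin (m + 1)) (Fin (m + 1)) ℂ)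

theorem alVec_mul_right : alVec α D (F * X) * F = alVec α (fun k v => D k v * F) X := by
  simp only [alVec, Finset.sum_mul, Matrix.smul_mul, Matrix.sub_mul, pairing_mul_rotate]

theorem mul_alVec : F * alVec α D (X * F) = alVec α (fun k v => F * D k v) X := by
  simp only [alVec, Finset.mul_sum, Matrix.mul_smul, Matrix.mul_sub, pairing_mul_left]

variable {D D'} in
theorem alVec_add (h : ∀ k, D k = 0 ∨ D' k = 0) :
    alVec α D X + alVec α D' X = alVec α (D + D') X := by
  rw [alVec, alVec, alVec, ← Finset.sum_add_distrib]
  refine Finset.sum_congr rfl fun k _ => ?_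
  rcases h k with hk | hk <;> simp [hk, pairing]

end AlVec

section HamVecCMV

variable {m : ℕ} {a : ℂ} {α : Fin m → ℂ}

/-- The derivative of `cmvAt a` at `α` in the direction `w`. -/
def dcmvAt (a : ℂ) (α w : Fin m → ℂ) : Matrix (Fin (m + 1)) (Fin (m + 1)) ℂ :=
  dfactor 0 α w * factor 1 (verblunsky a α) + factor 0 (verblunsky a α) * dfactor 1 α w

theorem hamVec_cmvAt (ha : ‖a‖ = 1) (hα : ∀ k, ‖α k‖ < 1)
    (X : Matrix (Fin (m + 1)) (Fin (m + 1)) ℂ) :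
    hamVec X (cmvAt a α) = alVec α (fun k v => dcmvAt a α (Pi.single k v)) X := by
  rw [cmvAt, cmv, hamVec_mul, hamVec_factor two_pos ha hα, hamVec_factor one_lt_two ha hα,
    alVec_mul_right, mul_alVec]
  refine alVec_add _ fun k => ?_
  rcases k.val.mod_two_eq_zero_or_one with hk | hk
  · exact Or.inr (funext fun v => by simp [dfactor_single, hk])
  · exact Or.inl (funext fun v => by simp [dfactor_single, hk])

end HamVecCMV

/-! ### Smoothness of the CMV matrix and comparison of the brackets -/

section MatrixCalculus

theorem hasDerivAt_matrix {𝕜 𝔸 ι : Type*} [NontriviallyNormedField 𝕜] [NormedRing 𝔸]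
    [NormedAlgebra 𝕜 𝔸] [Finite ι] {F : 𝕜 → Matrix ι ι 𝔸} {F' : Matrix ι ι 𝔸} {t : 𝕜} :
    HasDerivAt F F' t ↔ ∀ i j, HasDerivAt (fun s => F s i j) (F' i j) t :=
  have := Fintype.ofFinite ι
  hasDerivAt_pi.trans (forall_congr' fun _ => hasDerivAt_pi)

variable {𝕜 𝔸 E ι : Type*} [NontriviallyNormedField 𝕜] [Fintype ι]

section Smooth

variable [NormedAddCommGroup E] [NormedSpace 𝕜 E] [NormedRing 𝔸] [NormedAlgebra 𝕜 𝔸]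
  {k : WithTop ℕ∞} {F G : E → Matrix ι ι 𝔸} {x : E}

theorem contDiffAt_matrix :
    ContDiffAt 𝕜 k F x ↔ ∀ i j, ContDiffAt 𝕜 k (fun y => F y i j) x :=
  contDiffAt_pi.trans (forall_congr' fun _ => contDiffAt_pi)

theorem contDiffAt_matrix_mul (hF : ContDiffAt 𝕜 k F x) (hG : ContDiffAt 𝕜 k G x) :
    ContDiffAt 𝕜 k (fun y => F y * G y) x := by
  refine contDiffAt_matrix.2 fun i j => ?_
  simp only [Matrix.mul_apply]
  exact ContDiffAt.sum fun l _ => (contDiffAt_matrix.1 hF i l).mul (contDiffAt_matrix.1 hG l j)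

end Smooth

variable [NormedRing 𝔸] [NormedAlgebra 𝕜 𝔸] {F G : 𝕜 → Matrix ι ι 𝔸} {F' G' : Matrix ι ι 𝔸} {t : 𝕜}

theorem hasDerivAt_matrix_mul (hF : HasDerivAt F F' t) (hG : HasDerivAt G G' t) :
    HasDerivAt (fun s => F s * G s) (F' * G t + F t * G') t := by
  refine hasDerivAt_matrix.2 fun i j => ?_
  simp only [Matrix.add_apply, Matrix.mul_apply, ← Finset.sum_add_distrib]
  exact HasDerivAt.fun_sum fun l _ => (hasDerivAt_matrix.1 hF i l).mul (hasDerivAt_matrix.1 hG l j)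

end MatrixCalculus

theorem one_sub_norm_sq_ne_zero {z : ℂ} (hz : ‖z‖ < 1) : 1 - ‖z‖ ^ 2 ≠ 0 :=
  (sub_pos.2 (pow_lt_one₀ (norm_nonneg z) hz two_ne_zero)).ne'

theorem contDiffAt_rho {z : ℂ} (hz : ‖z‖ < 1) : ContDiffAt ℝ ∞ rho z :=
  (Real.contDiffAt_sqrt (one_sub_norm_sq_ne_zero hz)).comp z
    (contDiffAt_const.sub (contDiff_norm_sq ℝ).contDiffAt)

theorem contDiffAt_xi {z : ℂ} (hz : ‖z‖ < 1) : ContDiffAt ℝ ∞ xi z := by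
  have hrho : ContDiffAt ℝ ∞ (fun w => (rho w : ℂ)) z :=
    Complex.ofRealCLM.contDiff.contDiffAt.comp z (contDiffAt_rho hz)
  refine contDiffAt_matrix.2 fun i j => ?_
  fin_cases i <;> fin_cases j
  · exact Complex.conjCLE.contDiff.contDiffAt
  · exact hrho
  · exact hrho
  · exact contDiffAt_id.neg

section Curves

variable {γ : ℝ → ℂ} {w : ℂ} {t : ℝ}

theorem hasDerivAt_rho (hγ : HasDerivAt γ w t) (ht : ‖γ t‖ < 1) :
    HasDerivAt (fun s => rho (γ s)) (drho (γ t) w) t := by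
  refine ((hγ.norm_sq.const_sub 1).sqrt (one_sub_norm_sq_ne_zero ht)).congr_deriv ?_
  rw [Complex.inner, drho, rho]
  simp only [Complex.mul_re, Complex.conj_re, Complex.conj_im]
  field_simp
  ring

theorem hasDerivAt_xi (hγ : HasDerivAt γ w t) (ht : ‖γ t‖ < 1) :
    HasDerivAt (fun s => xi (γ s)) (dxi (γ t) w) t := by
  refine hasDerivAt_matrix.2 fun i j => ?_
  fin_cases i <;> fin_cases j
  · exact Complex.conjCLE.hasFDerivAt.comp_hasDerivAt t hγ
  · exact (hasDerivAt_rho hγ ht).ofReal_comp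
  · exact (hasDerivAt_rho hγ ht).ofReal_comp
  · exact hγ.neg

end Curves

section CMVCalculus

variable {m p : ℕ} {α : Fin m → ℂ}

theorem factor_eq_sum_embedBlock (hp : p < 2) (a : ℂ) (α : Fin m → ℂ) :
    factor p (verblunsky a α)
      = (∑ k : Fin m, if k.val % 2 = p then embedBlock k (xi (α k)) else 0)
        + ((if m % 2 = p then Matrix.single (Fin.last m) (Fin.last m) (conj a) else 0)
          + if p ≠ 0 then Matrix.single (0 : Fin (m + 1)) (0 : Fin (m + 1)) 1 else 0) := by
  rw [eq_sum_embedBlock hp (H := factor p (verblunsky a α)) fun _ _ => factor_apply_of_block_ne,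
    add_assoc]
  refine congrArg₂ _ (Finset.sum_congr rfl fun k _ => ?_) (congrArg₂ _ ?_ ?_)
  · exact ite_congr rfl (fun hk => by rw [factor_submatrix_blockIdx hk]) fun _ => rfl
  · exact ite_congr rfl (fun hm => by simp [factor, hm]) fun _ => rfl
  · exact ite_congr rfl (fun hp0 => by simp [factor, hp0.symm]) fun _ => rfl

theorem contDiffAt_factor (hp : p < 2) (a : ℂ) (hα : ∀ k, ‖α k‖ < 1) :
    ContDiffAt ℝ ∞ (fun β => factor p (verblunsky a β)) α := by
  simp only [factor_eq_sum_embedBlock hp]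
  refine (ContDiffAt.sum fun k _ => ?_).add contDiffAt_const
  split_ifs
  · exact (embedBlock k).toContinuousLinearMap.contDiff.contDiffAt.comp α
      (ContDiffAt.comp (g := xi) α (contDiffAt_xi (hα k)) (contDiff_apply ℝ ℂ k).contDiffAt)
  · exact contDiffAt_const

theorem hasDerivAt_factor (hp : p < 2) (a : ℂ) {β : ℝ → Fin m → ℂ} {w : Fin m → ℂ} {t : ℝ}
    (hβ : HasDerivAt β w t) (ht : ∀ k, ‖β t k‖ < 1) :
    HasDerivAt (fun s => factor p (verblunsky a (β s))) (dfactor p (β t) w) t := by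
  simp only [factor_eq_sum_embedBlock hp, dfactor]
  refine (HasDerivAt.fun_sum fun k _ => ?_).add_const _
  split_ifs
  · exact (embedBlock k).toContinuousLinearMap.hasFDerivAt.comp_hasDerivAt t
      (hasDerivAt_xi (hasDerivAt_pi.1 hβ k) (ht k))
  · exact hasDerivAt_const _ _

theorem contDiffAt_cmvAt (a : ℂ) (hα : ∀ k, ‖α k‖ < 1) : ContDiffAt ℝ ∞ (cmvAt a) α :=
  contDiffAt_matrix_mul (contDiffAt_factor two_pos a hα) (contDiffAt_factor one_lt_two a hα)

theorem differentiableAt_cmvAt (a : ℂ) (hα : ∀ k, ‖α k‖ < 1) :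
    DifferentiableAt ℝ (cmvAt a) α :=
  (contDiffAt_cmvAt a hα).differentiableAt (by simp)

theorem fderiv_cmvAt (a : ℂ) (hα : ∀ k, ‖α k‖ < 1) (v : Fin m → ℂ) :
    fderiv ℝ (cmvAt a) α v = dcmvAt a α v := by
  have hline : HasDerivAt (fun t : ℝ => α + t • v) v 0 := by
    simpa using ((hasDerivAt_id (0 : ℝ)).smul_const v).const_add α
  have hα₀ : ∀ k, ‖(α + (0 : ℝ) • v) k‖ < 1 := by simpa using hα
  have hchain : HasDerivAt (fun t : ℝ => cmvAt a (α + t • v)) (fderiv ℝ (cmvAt a) α v) 0 :=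
    HasFDerivAt.comp_hasDerivAt_of_eq 0 (differentiableAt_cmvAt a hα).hasFDerivAt hline
      (by rw [zero_smul, add_zero])
  have hproduct := hasDerivAt_matrix_mul (hasDerivAt_factor two_pos a hline hα₀)
    (hasDerivAt_factor one_lt_two a hline hα₀)
  simp only [zero_smul, add_zero] at hproduct
  exact hchain.unique hproduct

theorem fderiv_comp_cmvAt (a : ℂ) (hα : ∀ k, ‖α k‖ < 1)
    {φ : Matrix (Fin (m + 1)) (Fin (m + 1)) ℂ → ℝ} (hφ : DifferentiableAt ℝ φ (cmvAt a α))
    (v : Fin m → ℂ) :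
    fderiv ℝ (fun β => φ (cmvAt a β)) α v = pairing (grad φ (cmvAt a α)) (dcmvAt a α v) := by
  rw [pairing_comm, pairing_grad, ← fderiv_cmvAt a hα]
  exact congrArg (· v) (fderiv_comp α hφ (differentiableAt_cmvAt a hα))

theorem gdBracket_eq_alBracket {a : ℂ} (ha : ‖a‖ = 1) (hα : ∀ k, ‖α k‖ < 1)
    {φ ψ : Matrix (Fin (m + 1)) (Fin (m + 1)) ℂ → ℝ}
    (hφ : DifferentiableAt ℝ φ (cmvAt a α)) (hψ : DifferentiableAt ℝ ψ (cmvAt a α)) :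
    gdBracket φ ψ (cmvAt a α)
      = alBracket (fun β => φ (cmvAt a β)) (fun β => ψ (cmvAt a β)) α := by
  rw [gdBracket_eq_pairing_hamVec, pairing_grad, hamVec_cmvAt ha hα, alVec, map_sum, alBracket]
  refine Finset.sum_congr rfl fun k _ => ?_
  simp only [map_smul, map_sub, smul_eq_mul, ← pairing_grad, fderiv_comp_cmvAt a hα hφ,
    fderiv_comp_cmvAt a hα hψ, pairing_comm _ (grad ψ _)]

end CMVCalculus

/-! ### Smooth dependence of eigenvalues and masses on the matrix -/

theorem hasDerivAt_prod_sub {𝕜 ι : Type*} [NontriviallyNormedField 𝕜] [DecidableEq ι] (s : Finset ι)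
    (ζ : ι → 𝕜) {j : ι} (hj : j ∈ s) :
    HasDerivAt (fun w : 𝕜 => ∏ k ∈ s, (w - ζ k)) (∏ k ∈ s.erase j, (ζ j - ζ k)) (ζ j) := by
  have hfactor : (fun w : 𝕜 => ∏ k ∈ s, (w - ζ k))
      = fun w => (w - ζ j) * ∏ k ∈ s.erase j, (w - ζ k) :=
    funext fun w => (Finset.mul_prod_erase s (fun k => w - ζ k) hj).symm
  have hdiff : DifferentiableAt 𝕜 (fun w : 𝕜 => ∏ k ∈ s.erase j, (w - ζ k)) (ζ j) := by
    fun_prop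
  rw [hfactor]
  exact (((hasDerivAt_id (ζ j)).sub_const (ζ j)).mul hdiff.hasDerivAt).congr_deriv (by simp)

theorem isInvertible_of_apply_one_ne_zero {𝕜 : Type*} [NontriviallyNormedField 𝕜]
    {L : 𝕜 →L[𝕜] 𝕜} (h : L 1 ≠ 0) : L.IsInvertible :=
  ⟨ContinuousLinearEquiv.unitsEquivAut 𝕜 (Units.mk0 (L 1) h), by ext; simp⟩

section SmoothSpectrum

variable {𝕜 𝔸 E ι : Type*} [NontriviallyNormedField 𝕜] [NormedCommRing 𝔸] [NormedAlgebra 𝕜 𝔸]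
  [NormedAddCommGroup E] [NormedSpace 𝕜 E] [Fintype ι] [DecidableEq ι] {k : WithTop ℕ∞}
  {g : E → 𝔸} {F : E → Matrix ι ι 𝔸} {x : E}

theorem contDiffAt_det (hF : ContDiffAt 𝕜 k F x) : ContDiffAt 𝕜 k (fun y => (F y).det) x := by
  simp only [det_apply']
  exact ContDiffAt.sum fun σ _ =>
    contDiffAt_const.mul (contDiffAt_prod fun i _ => contDiffAt_matrix.1 hF _ _)

theorem contDiffAt_adjugate (hF : ContDiffAt 𝕜 k F x) (i j : ι) :
    ContDiffAt 𝕜 k (fun y => (F y).adjugate i j) x := by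
  simp only [adjugate_apply]
  refine contDiffAt_det (contDiffAt_matrix.2 fun p q => ?_)
  by_cases hp : p = j
  · subst hp
    simpa only [updateRow_self] using contDiffAt_const
  · simpa only [updateRow_ne hp] using contDiffAt_matrix.1 hF p q

theorem contDiffAt_smul_one_sub (hg : ContDiffAt 𝕜 k g x) (hF : ContDiffAt 𝕜 k F x) :
    ContDiffAt 𝕜 k (fun y => g y • (1 : Matrix ι ι 𝔸) - F y) x := by
  refine contDiffAt_matrix.2 fun i j => ?_
  simp only [Matrix.sub_apply, Matrix.smul_apply, smul_eq_mul]
  exact (hg.mul contDiffAt_const).sub (contDiffAt_matrix.1 hF i j)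

theorem exists_contDiffAt_root_det {C : Matrix ι ι ℂ} {z d : ℂ}
    (h0 : (z • (1 : Matrix ι ι ℂ) - C).det = 0)
    (hd : HasDerivAt (fun w : ℂ => (w • (1 : Matrix ι ι ℂ) - C).det) d z) (hd0 : d ≠ 0) :
    ∃ g : Matrix ι ι ℂ → ℂ, ContDiffAt ℝ ∞ g C ∧
      ∀ᶠ p in 𝓝 (C, z), (p.2 • (1 : Matrix ι ι ℂ) - p.1).det = 0 → g p.1 = p.2 := by
  set f : Matrix ι ι ℂ × ℂ → ℂ := fun p => (p.2 • (1 : Matrix ι ι ℂ) - p.1).det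
  have hf : ContDiffAt ℂ ∞ f (C, z) :=
    contDiffAt_det (contDiffAt_smul_one_sub contDiffAt_snd contDiffAt_fst)
  have hn : (∞ : WithTop ℕ∞) ≠ 0 := by simp
  have hpartial : fderiv ℂ f (C, z) (0, 1) = d :=
    ((hf.differentiableAt hn).hasFDerivAt.comp_hasDerivAt z
      ((hasDerivAt_const z C).prodMk (hasDerivAt_id z))).unique hd
  have hinv : (fderiv ℂ f (C, z) ∘L .inr ℂ (Matrix ι ι ℂ) ℂ).IsInvertible :=
    isInvertible_of_apply_one_ne_zero (by simpa [hpartial] using hd0)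
  refine ⟨hf.implicitFunction hn hinv,
    (hf.contDiffAt_implicitFunction hn hinv).restrict_scalars ℝ, ?_⟩
  filter_upwards [hf.eventually_apply_eq_iff_implicitFunction hn hinv] with p hp h
  exact hp.1 (h.trans h0.symm)

theorem exists_contDiffAt_eigenvalue {C W : Matrix ι ι ℂ} {ζ : ι → ℂ} (hW : W * Wᴴ = 1)
    (hC : C = W * diagonal ζ * Wᴴ) (hζ : Function.Injective ζ) (j : ι) :
    ∃ g : Matrix ι ι ℂ → ℂ, ContDiffAt ℝ ∞ g C ∧
      ∀ᶠ p in 𝓝 (C, ζ j), (p.2 • (1 : Matrix ι ι ℂ) - p.1).det = 0 → g p.1 = p.2 := by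
  have hdet := det_smul_one_sub hW hC
  refine exists_contDiffAt_root_det (d := ∏ k ∈ Finset.univ.erase j, (ζ j - ζ k)) ?_ ?_ ?_
  · rw [hdet]
    exact Finset.prod_eq_zero (Finset.mem_univ j) (sub_self _)
  · simpa only [hdet] using hasDerivAt_prod_sub Finset.univ ζ (Finset.mem_univ j)
  · exact Finset.prod_ne_zero_iff.2 fun k hk =>
      sub_ne_zero.2 (hζ.ne (Finset.ne_of_mem_erase hk).symm)

/-- The mass at the eigenvalue `g B` of the spectral measure of `B` and `e_i`, as a rational
function of `g B` and of the entries of `B`. -/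
def massFormula (g : Matrix ι ι ℂ → ℂ) (i : ι) (B : Matrix ι ι ℂ) : ℝ :=
  ((g B • (1 : Matrix ι ι ℂ) - B).adjugate i i
    / (g B • (1 : Matrix ι ι ℂ) - B).adjugate.trace).re

theorem contDiffAt_massFormula {g : Matrix ι ι ℂ → ℂ} {C : Matrix ι ι ℂ} {k : WithTop ℕ∞}
    (hg : ContDiffAt ℝ k g C) (i : ι)
    (hC : (g C • (1 : Matrix ι ι ℂ) - C).adjugate.trace ≠ 0) :
    ContDiffAt ℝ k (massFormula g i) C := by
  have hadj := contDiffAt_adjugate (contDiffAt_smul_one_sub hg contDiffAt_id)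
  have htrace : ContDiffAt ℝ k (fun B => (g B • (1 : Matrix ι ι ℂ) - B).adjugate.trace) C :=
    ContDiffAt.sum fun l _ => hadj l l
  unfold massFormula
  simp only [div_eq_mul_inv]
  exact Complex.reCLM.contDiff.contDiffAt.comp C ((hadj i i).mul (htrace.inv hC))

end SmoothSpectrum

section Labelling

variable {m : ℕ} {a : ℂ} {U : Set (Matrix (Fin (m + 1)) (Fin (m + 1)) ℂ)}
  {θ : Matrix (Fin (m + 1)) (Fin (m + 1)) ℂ → Fin (m + 1) → ℝ}
  {B C : Matrix (Fin (m + 1)) (Fin (m + 1)) ℂ}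

/-- The eigenvalue `e^{iθ_j}` of `B`. -/
abbrev eigenvalue {n : ℕ} (θ : Matrix (Fin n) (Fin n) ℂ → Fin n → ℝ) (B : Matrix (Fin n) (Fin n) ℂ)
    (j : Fin n) : ℂ :=
  Complex.exp (θ B j * Complex.I)

theorem norm_eigenvalue (j : Fin (m + 1)) : ‖eigenvalue θ B j‖ = 1 :=
  Complex.norm_exp_ofReal_mul_I _

theorem exists_diagonalization_of_isLabelling (ha : ‖a‖ = 1) (hθ : IsLabelling (leaf m a ∩ U) θ)
    (hB : B ∈ leaf m a ∩ U) :
    ∃ W : Matrix (Fin (m + 1)) (Fin (m + 1)) ℂ, W * Wᴴ = 1 ∧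
      B = W * diagonal (eigenvalue θ B) * Wᴴ ∧ ∀ j, mass θ j B = ‖W 0 j‖ ^ 2 := by
  obtain ⟨α, hα, hBα⟩ := hB.1
  refine exists_unitary_diagonalization ?_ (hθ.injective B hB) norm_eigenvalue fun j => ?_
  · rw [hBα]
    exact cmvAt_mul_conjTranspose ha hα
  · rw [← hθ.range_eq B hB]
    exact ⟨j, rfl⟩

theorem mulVec_single_ne_zero {W : Matrix (Fin (m + 1)) (Fin (m + 1)) ℂ} (hW : W * Wᴴ = 1)
    (j : Fin (m + 1)) : W *ᵥ Pi.single j 1 ≠ 0 := fun h => by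
  have := congrArg (fun x => Wᴴ *ᵥ x) h
  simp only [mulVec_mulVec, mul_eq_one_comm.1 hW, one_mulVec, mulVec_zero] at this
  simpa using congrFun this j

theorem mass_pos (ha : ‖a‖ = 1) (hθ : IsLabelling (leaf m a ∩ U) θ) (hB : B ∈ leaf m a ∩ U)
    (j : Fin (m + 1)) : 0 < mass θ j B := by
  obtain ⟨W, hW, hBW, hmass⟩ := exists_diagonalization_of_isLabelling ha hθ hB
  obtain ⟨α, hα, rfl⟩ := hB.1
  have heigen : cmvAt a α *ᵥ (W *ᵥ Pi.single j 1)
      = eigenvalue θ (cmvAt a α) j • (W *ᵥ Pi.single j 1) := by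
    conv_lhs => rw [hBW]
    rw [mulVec_mulVec, Matrix.mul_assoc, mul_eq_one_comm.1 hW, Matrix.mul_one, ← mulVec_mulVec,
      diagonal_mulVec_single, ← mulVec_smul, ← Pi.single_smul, smul_eq_mul]
  rw [hmass]
  refine pow_pos (norm_pos_iff.2 ?_) 2
  simpa using eigenvector_cmvAt_zero_ne_zero ha (Complex.exp_ne_zero _) hα
    (mulVec_single_ne_zero hW j) heigen

theorem det_eigenvalue_smul_one_sub (ha : ‖a‖ = 1) (hθ : IsLabelling (leaf m a ∩ U) θ)
    (hB : B ∈ leaf m a ∩ U) (j : Fin (m + 1)) :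
    (eigenvalue θ B j • (1 : Matrix (Fin (m + 1)) (Fin (m + 1)) ℂ) - B).det = 0 := by
  obtain ⟨W, hW, hBW, -⟩ := exists_diagonalization_of_isLabelling ha hθ hB
  rw [det_smul_one_sub hW hBW]
  exact Finset.prod_eq_zero (Finset.mem_univ j) (sub_self _)

theorem massFormula_eq_mass (ha : ‖a‖ = 1) (hθ : IsLabelling (leaf m a ∩ U) θ)
    (hB : B ∈ leaf m a ∩ U) {g : Matrix (Fin (m + 1)) (Fin (m + 1)) ℂ → ℂ} {j : Fin (m + 1)}
    (hg : g B = eigenvalue θ B j) : massFormula g 0 B = mass θ j B := by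
  obtain ⟨W, hW, hBW, hmass⟩ := exists_diagonalization_of_isLabelling ha hθ hB
  rw [massFormula, hg, ← (norm_sq_eq_adjugate_div_trace (hθ.injective B hB) hW hBW 0 j).2,
    hmass, Complex.ofReal_re]

theorem tendsto_eigenvalue (hU : IsOpen U) (hθ : IsLabelling (leaf m a ∩ U) θ)
    (hC : C ∈ leaf m a ∩ U) (j : Fin (m + 1)) :
    Filter.Tendsto (fun B => eigenvalue θ B j) (𝓝[leaf m a] C) (𝓝 (eigenvalue θ C j)) := by
  have hθj : Filter.Tendsto (fun B => θ B j) (𝓝[leaf m a] C) (𝓝 (θ C j)) := by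
    rw [← nhdsWithin_inter_of_mem' (nhdsWithin_le_nhds (hU.mem_nhds hC.2))]
    exact tendsto_pi_nhds.1 (hθ.continuousOn C hC).tendsto j
  have hexp : Continuous fun x : ℝ => Complex.exp (x * Complex.I) := by fun_prop
  exact (hexp.tendsto (θ C j)).comp hθj

theorem exists_extension_eigenvalue (ha : ‖a‖ = 1) (hU : IsOpen U)
    (hθ : IsLabelling (leaf m a ∩ U) θ) (hC : C ∈ leaf m a ∩ U) (j : Fin (m + 1)) :
    ∃ g : Matrix (Fin (m + 1)) (Fin (m + 1)) ℂ → ℂ, ContDiffAt ℝ ∞ g C ∧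
      ∀ᶠ B in 𝓝[leaf m a] C, g B = eigenvalue θ B j := by
  obtain ⟨W, hW, hCW, -⟩ := exists_diagonalization_of_isLabelling ha hθ hC
  obtain ⟨g, hg, hroot⟩ := exists_contDiffAt_eigenvalue hW hCW (hθ.injective C hC) j
  have hpair := (Filter.tendsto_id.mono_left nhdsWithin_le_nhds).prodMk_nhds
    (tendsto_eigenvalue hU hθ hC j)
  refine ⟨g, hg, ?_⟩
  filter_upwards [hpair.eventually hroot, inter_mem_nhdsWithin _ (hU.mem_nhds hC.2)]
    with B hgB hB using hgB (det_eigenvalue_smul_one_sub ha hθ hB j)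

theorem exists_extension_mass (ha : ‖a‖ = 1) (hU : IsOpen U)
    (hθ : IsLabelling (leaf m a ∩ U) θ) (hC : C ∈ leaf m a ∩ U) (j : Fin (m + 1)) :
    ∃ M : Matrix (Fin (m + 1)) (Fin (m + 1)) ℂ → ℝ, ContDiffAt ℝ ∞ M C ∧
      ExtendsNear (leaf m a) (mass θ j) M C := by
  obtain ⟨W, hW, hCW, -⟩ := exists_diagonalization_of_isLabelling ha hθ hC
  obtain ⟨g, hg, hgθ⟩ := exists_extension_eigenvalue ha hU hθ hC j
  refine ⟨massFormula g 0, contDiffAt_massFormula hg 0 ?_, ?_⟩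
  · rw [hgθ.self_of_nhdsWithin hC.1]
    exact (norm_sq_eq_adjugate_div_trace (hθ.injective C hC) hW hCW 0 j).1
  · filter_upwards [hgθ, inter_mem_nhdsWithin _ (hU.mem_nhds hC.2)] with B hgB hB
      using massFormula_eq_mass ha hθ hB hgB

theorem exists_extension_logRatio (ha : ‖a‖ = 1) (hU : IsOpen U)
    (hθ : IsLabelling (leaf m a ∩ U) θ) (hC : C ∈ leaf m a ∩ U) (j k : Fin (m + 1)) :
    ∃ φ : Matrix (Fin (m + 1)) (Fin (m + 1)) ℂ → ℝ, ContDiffAt ℝ ∞ φ C ∧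
      ExtendsNear (leaf m a) (logRatio θ j k) φ C := by
  obtain ⟨M, hM, hMj⟩ := exists_extension_mass ha hU hθ hC j
  obtain ⟨N, hN, hNk⟩ := exists_extension_mass ha hU hθ hC k
  have hMpos : 0 < M C := hMj.self_of_nhdsWithin hC.1 ▸ mass_pos ha hθ hC j
  have hNpos : 0 < N C := hNk.self_of_nhdsWithin hC.1 ▸ mass_pos ha hθ hC k
  refine ⟨fun B => Real.log (M B / N B), (hM.div hN hNpos.ne').log (div_pos hMpos hNpos).ne', ?_⟩
  filter_upwards [hMj, hNk] with B hMB hNB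
  rw [logRatio, hMB, hNB]

end Labelling

/-! ### The Ablowitz–Ladik brackets of the masses -/

section Coordinates

variable {m : ℕ} {α : Fin m → ℂ}

theorem eventually_norm_lt_one (hα : ∀ k, ‖α k‖ < 1) : ∀ᶠ β in 𝓝 α, ∀ k, ‖β k‖ < 1 :=
  Filter.eventually_all.2 fun k =>
    (continuous_apply k).norm.continuousAt.eventually_lt_const (hα k)

theorem tendsto_cmvAt_leaf (a : ℂ) (hα : ∀ k, ‖α k‖ < 1) :
    Filter.Tendsto (cmvAt a) (𝓝 α) (𝓝[leaf m a] cmvAt a α) :=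
  tendsto_nhdsWithin_iff.2 ⟨(contDiffAt_cmvAt a hα).continuousAt,
    (eventually_norm_lt_one hα).mono fun β hβ => ⟨β, hβ, rfl⟩⟩

theorem contDiffAt_comp_cmvAt {E : Type*} [NormedAddCommGroup E] [NormedSpace ℝ E] {a : ℂ}
    {F : Matrix (Fin (m + 1)) (Fin (m + 1)) ℂ → E} (hα : ∀ k, ‖α k‖ < 1)
    (h : ∃ φ : Matrix (Fin (m + 1)) (Fin (m + 1)) ℂ → E, ContDiffAt ℝ ∞ φ (cmvAt a α) ∧
      ∀ᶠ B in 𝓝[leaf m a] cmvAt a α, φ B = F B) :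
    ContDiffAt ℝ ∞ (fun β => F (cmvAt a β)) α := by
  obtain ⟨φ, hφ, hφF⟩ := h
  exact (hφ.comp α (contDiffAt_cmvAt a hα)).congr_of_eventuallyEq
    (((tendsto_cmvAt_leaf a hα).eventually hφF).mono fun β h => h.symm)

end Coordinates

section CauchyTransform

theorem cauchyBracket_div_one_sub {z w f g : ℂ} (hzw : z ≠ w) (hf : 1 - z * f ≠ 0)
    (hg : 1 - w * g ≠ 0) :
    cauchyBracket z w (f / (1 - z * f)) (g / (1 - w * g))
      = 1 / (1 - z * f) ^ 2 * (1 / (1 - w * g) ^ 2 * schurBracket z w f g) := by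
  have : z - w ≠ 0 := sub_ne_zero.2 hzw
  rw [cauchyBracket, schurBracket]
  field_simp
  ring

variable {E ι : Type*} [NormedAddCommGroup E] [NormedSpace ℝ E] [Fintype ι] {x : E} {z : ℂ}

theorem hasFDerivAt_cauchy {μ ζ : E → ι → ℂ} {dμ dζ : ι → E →L[ℝ] ℂ}
    (hμ : ∀ j, HasFDerivAt (fun y => μ y j) (dμ j) x)
    (hζ : ∀ j, HasFDerivAt (fun y => ζ y j) (dζ j) x) (hz : ∀ j, ζ x j - z ≠ 0) :
    HasFDerivAt (fun y => cauchy (μ y) (ζ y) z) (dcauchy (μ x) (ζ x) dμ dζ z) x :=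
  HasFDerivAt.fun_sum fun j _ => hasFDerivAt_div (hμ j) ((hζ j).sub_const z) (hz j)

theorem hasFDerivAt_div_one_sub {f : E → ℂ} {D : E →L[ℝ] ℂ} (hf : HasFDerivAt f D x)
    (h0 : 1 - z * f x ≠ 0) :
    HasFDerivAt (fun y => f y / (1 - z * f y)) ((1 / (1 - z * f x) ^ 2) • D) x := by
  refine (hasFDerivAt_div hf ((hf.const_mul z).const_sub 1) h0).congr_fderiv ?_
  ext v
  simp only [_root_.sub_apply, _root_.neg_apply, _root_.smul_apply, smul_eq_mul]
  field_simp
  ring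

end CauchyTransform

section Masses

variable {m : ℕ} {a z : ℂ} {U : Set (Matrix (Fin (m + 1)) (Fin (m + 1)) ℂ)}
  {θ : Matrix (Fin (m + 1)) (Fin (m + 1)) ℂ → Fin (m + 1) → ℝ} {α : Fin m → ℂ}

theorem one_sub_mul_schur_ne_zero (ha : ‖a‖ ≤ 1) (hz : ‖z‖ < 1) (hα : ∀ k, ‖α k‖ < 1)
    (k : Fin (m + 1)) : 1 - z * schur a z α k ≠ 0 := by
  have hlt : ‖z * schur a z α k‖ < 1 := by
    rw [norm_mul]
    exact mul_lt_one_of_nonneg_of_lt_one_left (norm_nonneg z) hz (norm_schur_le ha hz hα k)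
  exact sub_ne_zero_of_norm_lt_one norm_one hlt

theorem schur_div_eq_cauchy (ha : ‖a‖ = 1) (hθ : IsLabelling (leaf m a ∩ U) θ)
    (hα : ∀ k, ‖α k‖ < 1) (hαU : cmvAt a α ∈ U) (hz : ‖z‖ < 1) :
    schur a z α 0 / (1 - z * schur a z α 0)
      = cauchy (fun j => (mass θ j (cmvAt a α) : ℂ)) (eigenvalue θ (cmvAt a α)) z := by
  obtain ⟨W, hW, hBW, hmass⟩ :=
    exists_diagonalization_of_isLabelling ha hθ (B := cmvAt a α) ⟨⟨α, hα, rfl⟩, hαU⟩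
  obtain ⟨y, hy0, hy⟩ := exists_cmvAt_mulVec_sub ha hz hα
  have hcauchy := apply_eq_mul_cauchy hW hBW
    (fun j => sub_ne_zero_of_norm_lt_one (norm_eigenvalue j) hz) hy
  simp only [hmass]
  rw [div_eq_iff (one_sub_mul_schur_ne_zero ha.le hz hα 0), mul_comm, ← hcauchy, hy0]

theorem eventually_schur_div_eq_cauchy (ha : ‖a‖ = 1) (hU : IsOpen U)
    (hθ : IsLabelling (leaf m a ∩ U) θ) (hα : ∀ k, ‖α k‖ < 1) (hαU : cmvAt a α ∈ U)
    (hz : ‖z‖ < 1) :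
    ∀ᶠ β in 𝓝 α, schur a z β 0 / (1 - z * schur a z β 0)
      = cauchy (fun j => (mass θ j (cmvAt a β) : ℂ)) (eigenvalue θ (cmvAt a β)) z := by
  filter_upwards [eventually_norm_lt_one hα,
    (contDiffAt_cmvAt a hα).continuousAt.eventually (hU.mem_nhds hαU)] with β hβ hβU
    using schur_div_eq_cauchy ha hθ hβ hβU hz

/-- The differential at `α` of a real function, with complex values. -/
def ofRealFDeriv (f : (Fin m → ℂ) → ℝ) (α : Fin m → ℂ) : (Fin m → ℂ) →L[ℝ] ℂ :=
  Complex.ofRealCLM.comp (fderiv ℝ f α)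

theorem differentiableAt_mass (ha : ‖a‖ = 1) (hU : IsOpen U) (hθ : IsLabelling (leaf m a ∩ U) θ)
    (hα : ∀ k, ‖α k‖ < 1) (hαU : cmvAt a α ∈ U) (j : Fin (m + 1)) :
    DifferentiableAt ℝ (fun β => mass θ j (cmvAt a β)) α :=
  (contDiffAt_comp_cmvAt hα
    (exists_extension_mass ha hU hθ ⟨⟨α, hα, rfl⟩, hαU⟩ j)).differentiableAt (by simp)

theorem differentiableAt_eigenvalue (ha : ‖a‖ = 1) (hU : IsOpen U)
    (hθ : IsLabelling (leaf m a ∩ U) θ) (hα : ∀ k, ‖α k‖ < 1) (hαU : cmvAt a α ∈ U)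
    (j : Fin (m + 1)) : DifferentiableAt ℝ (fun β => eigenvalue θ (cmvAt a β) j) α :=
  (contDiffAt_comp_cmvAt (F := fun B => eigenvalue θ B j) hα
    (exists_extension_eigenvalue ha hU hθ ⟨⟨α, hα, rfl⟩, hαU⟩ j)).differentiableAt (by simp)

theorem dcauchy_eq_smul_fderiv_schur (ha : ‖a‖ = 1) (hU : IsOpen U)
    (hθ : IsLabelling (leaf m a ∩ U) θ) (hα : ∀ k, ‖α k‖ < 1) (hαU : cmvAt a α ∈ U)
    (hz : ‖z‖ < 1) :
    dcauchy (fun j => (mass θ j (cmvAt a α) : ℂ)) (eigenvalue θ (cmvAt a α))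
        (fun j => ofRealFDeriv (fun β => mass θ j (cmvAt a β)) α)
        (fun j => fderiv ℝ (fun β => eigenvalue θ (cmvAt a β) j) α) z
      = (1 / (1 - z * schur a z α 0) ^ 2) • fderiv ℝ (fun β => schur a z β 0) α := by
  have hcauchy := hasFDerivAt_cauchy
    (μ := fun β j => (mass θ j (cmvAt a β) : ℂ)) (ζ := fun β => eigenvalue θ (cmvAt a β))
    (fun j => Complex.ofRealCLM.hasFDerivAt.comp α
      (differentiableAt_mass ha hU hθ hα hαU j).hasFDerivAt)
    (fun j => (differentiableAt_eigenvalue ha hU hθ hα hαU j).hasFDerivAt)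
    fun j => sub_ne_zero_of_norm_lt_one (norm_eigenvalue j) hz
  have hschur := hasFDerivAt_div_one_sub (differentiableAt_schur ha.le hz hα 0).hasFDerivAt
    (one_sub_mul_schur_ne_zero ha.le hz hα 0)
  exact (hcauchy.congr_of_eventuallyEq
    (eventually_schur_div_eq_cauchy ha hU hθ hα hαU hz)).unique hschur

theorem alForm_mass (ha : ‖a‖ = 1) (hU : IsOpen U) (hθ : IsLabelling (leaf m a ∩ U) θ)
    (hα : ∀ k, ‖α k‖ < 1) (hαU : cmvAt a α ∈ U) {j k : Fin (m + 1)} (hjk : j ≠ k) :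
    alForm α (ofRealFDeriv (fun β => mass θ j (cmvAt a β)) α)
        (ofRealFDeriv (fun β => mass θ k (cmvAt a β)) α)
      = 2 * Complex.I * mass θ j (cmvAt a α) * mass θ k (cmvAt a α)
        * ((eigenvalue θ (cmvAt a α) j + eigenvalue θ (cmvAt a α) k)
            / (eigenvalue θ (cmvAt a α) j - eigenvalue θ (cmvAt a α) k)
          + cauchyGauge (fun j => (mass θ j (cmvAt a α) : ℂ)) (eigenvalue θ (cmvAt a α)) j
          - cauchyGauge (fun j => (mass θ j (cmvAt a α) : ℂ)) (eigenvalue θ (cmvAt a α)) k) := by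
  have hinj : Function.Injective (eigenvalue θ (cmvAt a α)) :=
    hθ.injective _ ⟨⟨α, hα, rfl⟩, hαU⟩
  refine form_dmu_dmu (B := alForm α) (μ := fun j => (mass θ j (cmvAt a α) : ℂ))
    (dμ := fun j => ofRealFDeriv (fun β => mass θ j (cmvAt a β)) α)
    (dζ := fun j => fderiv ℝ (fun β => eigenvalue θ (cmvAt a β) j) α)
    hinj norm_eigenvalue (fun z w hz hw => ?_) hjk
  rcases eq_or_ne z w with rfl | hzw
  · rw [alForm_self, cauchyBracket, sub_self, zero_mul, mul_zero]
  · rw [dcauchy_eq_smul_fderiv_schur ha hU hθ hα hαU hz,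
      dcauchy_eq_smul_fderiv_schur ha hU hθ hα hαU hw, map_smul, map_smul, LinearMap.smul_apply,
      smul_eq_mul, smul_eq_mul, alForm_schur ha.le hα hz hw hzw,
      ← schur_div_eq_cauchy ha hθ hα hαU hz, ← schur_div_eq_cauchy ha hθ hα hαU hw,
      cauchyBracket_div_one_sub hzw (one_sub_mul_schur_ne_zero ha.le hz hα 0)
        (one_sub_mul_schur_ne_zero ha.le hw hα 0)]
    ring

end Masses

/-! ### The brackets of the log-ratios -/

theorem I_mul_add_div_sub_eq_cot {s t : ℝ}
    (h : Complex.exp (s * Complex.I) ≠ Complex.exp (t * Complex.I)) :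
    Complex.I * ((Complex.exp (s * Complex.I) + Complex.exp (t * Complex.I))
      / (Complex.exp (s * Complex.I) - Complex.exp (t * Complex.I)))
      = (Real.cot ((s - t) / 2) : ℂ) := by
  have hexp : Complex.exp (2 * Complex.I * (((s - t) / 2 : ℝ) : ℂ))
      = Complex.exp (s * Complex.I) / Complex.exp (t * Complex.I) := by
    rw [← Complex.exp_sub]
    congr 1
    push_cast
    ring
  rw [Complex.ofReal_cot, Complex.cot_eq_exp_ratio, hexp]
  have ht := Complex.exp_ne_zero (t * Complex.I)
  generalize Complex.exp (s * Complex.I) = x at *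
  generalize Complex.exp (t * Complex.I) = y at *
  have hxy : x - y ≠ 0 := sub_ne_zero.2 h
  have hyx : y - x ≠ 0 := sub_ne_zero.2 h.symm
  have hden : 1 - x / y ≠ 0 := by
    rw [one_sub_div ht]
    exact div_ne_zero hyx ht
  rw [eq_div_iff (mul_ne_zero Complex.I_ne_zero hden)]
  field_simp
  linear_combination (x + y) * (y - x) * Complex.I_sq

section LogRatio

variable {m : ℕ} {α : Fin m → ℂ}

theorem alBracket_congr {f f' g g' : (Fin m → ℂ) → ℝ} (hf : f =ᶠ[𝓝 α] f') (hg : g =ᶠ[𝓝 α] g') :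
    alBracket f g α = alBracket f' g' α := by
  rw [alBracket, alBracket, hf.fderiv_eq, hg.fderiv_eq]

theorem ofReal_alBracket (f g : (Fin m → ℂ) → ℝ) :
    (alBracket f g α : ℂ) = alForm α (ofRealFDeriv f α) (ofRealFDeriv g α) := by
  rw [alBracket, alForm_apply]
  push_cast
  rfl

theorem ofRealFDeriv_log_div {f g : (Fin m → ℂ) → ℝ} (hf : DifferentiableAt ℝ f α)
    (hg : DifferentiableAt ℝ g α) (hf0 : f α ≠ 0) (hg0 : g α ≠ 0) :
    ofRealFDeriv (fun β => Real.log (f β / g β)) α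
      = (1 / (f α : ℂ)) • ofRealFDeriv f α - (1 / (g α : ℂ)) • ofRealFDeriv g α := by
  have hlog : (fun β => Real.log (f β / g β)) =ᶠ[𝓝 α] fun β => Real.log (f β) - Real.log (g β) := by
    filter_upwards [hf.continuousAt.eventually_ne hf0, hg.continuousAt.eventually_ne hg0]
      with β hfβ hgβ using Real.log_div hfβ hgβ
  have hsub := (hf.hasFDerivAt.log hf0).sub (hg.hasFDerivAt.log hg0)
  rw [ofRealFDeriv, (hsub.congr_of_eventuallyEq hlog).fderiv]
  ext v
  simp [ofRealFDeriv]

theorem alBracket_log_div_log_div {ι : Type*} {μ : ι → (Fin m → ℂ) → ℝ}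
    (hμ : ∀ j, DifferentiableAt ℝ (μ j) α) (hμ0 : ∀ j, μ j α ≠ 0) {c : ι → ι → ℝ} {κ : ι → ℂ}
    (h : ∀ j k, j ≠ k → alForm α (ofRealFDeriv (μ j) α) (ofRealFDeriv (μ k) α)
      = 2 * μ j α * μ k α * (c j k + κ j - κ k))
    {i₁ i₂ i₃ : ι} (h₁₂ : i₁ ≠ i₂) (h₂₃ : i₂ ≠ i₃) (h₁₃ : i₁ ≠ i₃) :
    alBracket (fun β => Real.log (μ i₂ β / μ i₁ β)) (fun β => Real.log (μ i₃ β / μ i₁ β)) α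
      = 2 * c i₁ i₂ + 2 * c i₂ i₃ + 2 * c i₃ i₁ := by
  have hμ0' : ∀ j, (μ j α : ℂ) ≠ 0 := fun j => Complex.ofReal_ne_zero.2 (hμ0 j)
  have h₁ := hμ0' i₁
  have h₂ := hμ0' i₂
  have h₃ := hμ0' i₃
  apply Complex.ofReal_injective
  rw [ofReal_alBracket, ofRealFDeriv_log_div (hμ i₂) (hμ i₁) (hμ0 i₂) (hμ0 i₁),
    ofRealFDeriv_log_div (hμ i₃) (hμ i₁) (hμ0 i₃) (hμ0 i₁)]
  simp only [map_sub, map_smul, LinearMap.sub_apply, LinearMap.smul_apply, smul_eq_mul, alForm_self]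
  rw [alForm_swap α (ofRealFDeriv (μ i₁) α) (ofRealFDeriv (μ i₂) α),
    alForm_swap α (ofRealFDeriv (μ i₃) α) (ofRealFDeriv (μ i₁) α), h i₁ i₂ h₁₂, h i₂ i₃ h₂₃,
    h i₃ i₁ h₁₃.symm]
  push_cast
  field_simp
  ring

theorem alBracket_logRatio {a : ℂ} (ha : ‖a‖ = 1)
    {U : Set (Matrix (Fin (m + 1)) (Fin (m + 1)) ℂ)} (hU : IsOpen U)
    {θ : Matrix (Fin (m + 1)) (Fin (m + 1)) ℂ → Fin (m + 1) → ℝ}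
    (hθ : IsLabelling (leaf m a ∩ U) θ) (hα : ∀ k, ‖α k‖ < 1) (hαU : cmvAt a α ∈ U)
    {i₁ i₂ i₃ : Fin (m + 1)} (h₁₂ : i₁ ≠ i₂) (h₂₃ : i₂ ≠ i₃) (h₁₃ : i₁ ≠ i₃) :
    alBracket (fun β => logRatio θ i₂ i₁ (cmvAt a β)) (fun β => logRatio θ i₃ i₁ (cmvAt a β)) α
      = 2 * Real.cot ((θ (cmvAt a α) i₁ - θ (cmvAt a α) i₂) / 2)
        + 2 * Real.cot ((θ (cmvAt a α) i₂ - θ (cmvAt a α) i₃) / 2)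
        + 2 * Real.cot ((θ (cmvAt a α) i₃ - θ (cmvAt a α) i₁) / 2) := by
  have hmem : cmvAt a α ∈ leaf m a ∩ U := ⟨⟨α, hα, rfl⟩, hαU⟩
  refine alBracket_log_div_log_div (μ := fun j β => mass θ j (cmvAt a β))
    (c := fun j k => Real.cot ((θ (cmvAt a α) j - θ (cmvAt a α) k) / 2))
    (κ := fun j => Complex.I * cauchyGauge (fun j => (mass θ j (cmvAt a α) : ℂ))
      (eigenvalue θ (cmvAt a α)) j)
    (differentiableAt_mass ha hU hθ hα hαU) (fun j => (mass_pos ha hθ hmem j).ne')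
    (fun j k hjk => ?_) h₁₂ h₂₃ h₁₃
  rw [alForm_mass ha hU hθ hα hαU hjk, ← I_mul_add_div_sub_eq_cot ((hθ.injective _ hmem).ne hjk)]
  ring

end LogRatio

end

end CMV

/-- The masses are positive, and `{log (μ₂/μ₁), log (μ₃/μ₁)}` is given by the stated formula both
in the Ablowitz–Ladik bracket, for the functions of `α₀, …, α_{n-2}`, and in the Gelfand–Dikij
bracket, for any extensions of the two functions from the manifold of CMV matrices with fixed
determinant to the space of all matrices (smooth ones exist). Here `n = m + 1`. -/
theorem propositionP (m : ℕ) (a : ℂ) (ha : ‖a‖ = 1)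
    (U : Set (Matrix (Fin (m + 1)) (Fin (m + 1)) ℂ)) (hU : IsOpen U)
    (θ : Matrix (Fin (m + 1)) (Fin (m + 1)) ℂ → Fin (m + 1) → ℝ)
    (hθ : CMV.IsLabelling (CMV.leaf m a ∩ U) θ)
    (i₁ i₂ i₃ : Fin (m + 1)) (h₁₂ : i₁ ≠ i₂) (h₂₃ : i₂ ≠ i₃) (h₁₃ : i₁ ≠ i₃)
    (α : Fin m → ℂ) (hα : ∀ k, ‖α k‖ < 1) (hαU : CMV.cmvAt a α ∈ U)
    (C : Matrix (Fin (m + 1)) (Fin (m + 1)) ℂ) (hC : C = CMV.cmvAt a α)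
    (Ψ : ℝ)
    (hΨ : Ψ = 2 * Real.cot ((θ C i₁ - θ C i₂) / 2) + 2 * Real.cot ((θ C i₂ - θ C i₃) / 2)
      + 2 * Real.cot ((θ C i₃ - θ C i₁) / 2)) :
    (∀ j, 0 < CMV.mass θ j C) ∧
    (ContDiffAt ℝ ∞ (fun β => CMV.logRatio θ i₂ i₁ (CMV.cmvAt a β)) α ∧
      ContDiffAt ℝ ∞ (fun β => CMV.logRatio θ i₃ i₁ (CMV.cmvAt a β)) α ∧
      CMV.alBracket (fun β => CMV.logRatio θ i₂ i₁ (CMV.cmvAt a β))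
        (fun β => CMV.logRatio θ i₃ i₁ (CMV.cmvAt a β)) α = Ψ) ∧
    ((∃ φ ψ : Matrix (Fin (m + 1)) (Fin (m + 1)) ℂ → ℝ,
        ContDiffAt ℝ ∞ φ C ∧ ContDiffAt ℝ ∞ ψ C ∧
        CMV.ExtendsNear (CMV.leaf m a) (CMV.logRatio θ i₂ i₁) φ C ∧
        CMV.ExtendsNear (CMV.leaf m a) (CMV.logRatio θ i₃ i₁) ψ C) ∧
      ∀ φ ψ : Matrix (Fin (m + 1)) (Fin (m + 1)) ℂ → ℝ,
        DifferentiableAt ℝ φ C → DifferentiableAt ℝ ψ C →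
        CMV.ExtendsNear (CMV.leaf m a) (CMV.logRatio θ i₂ i₁) φ C →
        CMV.ExtendsNear (CMV.leaf m a) (CMV.logRatio θ i₃ i₁) ψ C →
        CMV.gdBracket φ ψ C = Ψ) := by
  subst hC hΨ
  have hmem : CMV.cmvAt a α ∈ CMV.leaf m a ∩ U := ⟨⟨α, hα, rfl⟩, hαU⟩
  have hbracket := CMV.alBracket_logRatio ha hU hθ hα hαU h₁₂ h₂₃ h₁₃
  have hext := CMV.exists_extension_logRatio ha hU hθ hmem
  refine ⟨CMV.mass_pos ha hθ hmem, ⟨CMV.contDiffAt_comp_cmvAt hα (hext i₂ i₁),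
    CMV.contDiffAt_comp_cmvAt hα (hext i₃ i₁), hbracket⟩, ?_, fun φ ψ hφ hψ hφθ hψθ => ?_⟩
  · obtain ⟨φ, hφ, hφθ⟩ := hext i₂ i₁
    obtain ⟨ψ, hψ, hψθ⟩ := hext i₃ i₁
    exact ⟨φ, ψ, hφ, hψ, hφθ, hψθ⟩
  · have hcmv := CMV.tendsto_cmvAt_leaf a hα
    rw [CMV.gdBracket_eq_alBracket ha hα hφ hψ, ← hbracket]
    exact CMV.alBracket_congr (hcmv.eventually hφθ) (hcmv.eventually hψθ)
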